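/- **Setting.** Consider first-order clausal logic without equality over a signature of constants, function symbols of positive arity and predicate symbols, with at least one constant. A clause is a finite multiset of literals; its width is its number of distinct variables. A compound term is a term $f(t_1,\dots,t_n)$ with $n\ge 1$; it is flat if all $t_i$ are variables or constants. A literal is flat if all its arguments are variables or constants, otherwise it is a compound-term literal. A clause $C$ is *simple* if every argument of its literals is a variable, a constant or a flat compound term; *covering* if every compound term in $C$ contains all variables of $C$; *strongly compatible* if all compound terms in $C$ have the same argument list. $C$ is *loosely guarded* (LG) if it is simple, covering and strongly compatible, and either ground or such that any two (not necessarily distinct) variables of $C$ occur together in some negative flat literal of $C$. **The system T-Res.** Let $\succ$ be the lexicographic path ordering for a well-founded total precedence in which function symbols are larger than constants and constants larger than predicate symbols; literals are compared by their atoms, with $\neg A$ next above $A$. A literal $L$ is (strictly) maximal with respect to $D$ if for some ground substitution $\tau$, $L\tau\succeq L'\tau$ ($L\tau\succ L'\tau$) for all $L'$ in $D$. In a ground clause nothing is selected. In a non-ground clause one negative compound-term literal is selected (by an arbitrary fixed choice) if there is one; otherwise nothing is selected if there is a positive compound-term literal; otherwise all negative literals are selected. *Factor*: from $C\vee A_1\vee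 A_2$ with nothing selected derive $(C\vee A_1)\sigma$, where $\sigma=\mathrm{mgu}(A_1\doteq A_2)$ and $A_1\sigma$ is maximal with respect to $C\sigma$. *T-Res*: the premises are variable-disjoint side premises $C_i=B_i\vee D_i$ ($1\le i\le n$), in which nothing is selected, and a main premise $C=\neg A_1\vee\dots\vee\neg A_n\vee D$. (a) If $n=1$, and either $\neg A_1$ is the only selected literal of $C$, or nothing is selected in $C$ and $\neg A_1\sigma$ is maximal with respect to $D\sigma$, where $\sigma=\mathrm{mgu}(A_1\doteq B_1)$, and if $B_1\sigma$ is strictly maximal with respect to $D_1\sigma$, derive $(D_1\vee D)\sigma$. (b) If $\neg A_1,\dots,\neg A_n$ are exactly the selected literals of $C$ and $\sigma'=\mathrm{mgu}(A_1\doteq B_1,\dots,A_n\doteq B_n)$ exists, call a variable $x$ of $A_1,\dots,A_n$ a top variable if the depth of $x\sigma'$ is greatest among the variables of $A_1,\dots,A_n$; let $S\neq\emptyset$ be the set of all $i$ such that $A_i$ contains a top variable, and $\sigma$ a simultaneous mgu of $A_i\doteq B_i$ for $i\in S$. If every $B_i$ is strictly maximal with respect to $D_i$, both after applying $\sigma'$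 and after applying $\sigma$, derive $\bigl(\bigvee_{i\in S}D_i\vee\bigvee_{i\notin S}\neg A_i\vee D\bigr)\sigma$. The premises resolved upon are $C$ and the $C_i$ with $i\in S$ (in (a), $C$ and $C_1$). Alternatively, all maximality conditions may be tested on the premises before any unifier is applied (a-priori eligibility); everything below holds for either convention. A clause is *deletable* in the presence of $N$ if it is a tautology (contains some $A$ and $\neg A$) or a variant of a clause in $N$. A *derivation step* from a clause set $N$ either adds the conclusion of a Factor or T-Res inference from variants of clauses in $N$, after repeated literals in the conclusion have been merged and provided that the result is not deletable in the presence of $N$, or removes a clause that is deletable in the presence of the remaining ones. $N$ is *saturated* if every such conclusion, with repeated literals merged, is deletable in the presence of $N$. **Theorem 5.** The T-Res system decides satisfiability of the class of LG clauses. That is, for every such precedence and selection and for either eligibility convention: 1. The conclusion of a Factor inference on an LG clause is an LG clause (in particular simple) and no wider than the premise. The conclusion of a T-Res inference on LG clauses is an LG clause (in particular simple) and no wider than at least one of the premises resolved upon. 2. (Refutational completeness.) A saturated set of LG clauses is unsatisfiable if and only if it contains the empty clause. 3. (Termination and decision.) Let $N$ be a finite set of LG clauses. There is no infinite derivation from $N$.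 Every set derived from $N$ is a finite set of LG clauses that contain only symbols occurring in $N$ and are each no wider than some clause of $N$. Every set $M$ derived from $N$ to which no further step applies is saturated, and $M$ contains the empty clause if and only if $N$ is unsatisfiable. -/

import Mathlib

universe u v

noncomputable section

namespace TopVar

/-! ### Syntax

A first-order signature is a language `L` of Mathlib: the constants are the function symbols of
arity `0`, the (proper) function symbols are those of positive arity, and the relation symbols are
the predicate symbols (arity `0`: propositional variables). There is no equality.
Variables are natural numbers. -/

/-- An atom `p(t₁, …, tₙ)`. -/
structure Atom (L : FirstOrder.Language.{u, v}) where
  arity : ℕ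
  rel : L.Relations arity
  args : Fin arity → L.Term ℕ

/-- A literal: an atom or a negated atom. -/
inductive Lit (L : FirstOrder.Language.{u, v}) where
  | pos : Atom L → Lit L
  | neg : Atom L → Lit L

/-- A clause is a finite multiset of literals, read as their disjunction;
`0` is the empty clause. -/
abbrev Clause (L : FirstOrder.Language.{u, v}) := Multiset (Lit L)

/-- Substitutions. -/
abbrev Sub (L : FirstOrder.Language.{u, v}) := ℕ → L.Term ℕ

variable {L : FirstOrder.Language.{u, v}}

/-- The atom of a literal. -/
def Lit.atom : Lit L → Atom L
  | .pos A => A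
  | .neg A => A

/-- The literal is negative. -/
def Lit.IsNeg : Lit L → Prop
  | .pos _ => False
  | .neg _ => True

/-- The variables of an atom. -/
def Atom.vars (A : Atom L) : Finset ℕ := Finset.univ.biUnion fun i => (A.args i).varFinset

/-- The variables of a literal. -/
def Lit.vars (l : Lit L) : Finset ℕ := l.atom.vars

/-- The variables of a clause. -/
def Clause.vars (C : Clause L) : Finset ℕ := (C.map Lit.vars).sup

/-- The width of a clause: its number of distinct variables. -/
def Clause.width (C : Clause L) : ℕ := (Clause.vars C).card

/-- A clause without variables. -/
def Clause.IsGround (C : Clause L) : Prop := Clause.vars C = ∅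

/-- Application of a substitution to an atom. -/
def Atom.subst (A : Atom L) (σ : Sub L) : Atom L := ⟨A.arity, A.rel, fun i => (A.args i).subst σ⟩

/-- Application of a substitution to a literal. -/
def Lit.subst : Lit L → Sub L → Lit L
  | .pos A, σ => .pos (A.subst σ)
  | .neg A, σ => .neg (A.subst σ)

/-- Application of a substitution to a clause. -/
def Clause.subst (C : Clause L) (σ : Sub L) : Clause L := C.map fun l => l.subst σ

/-- `C'` is a variant of `C`: it arises from `C` by a bijective renaming of variables. -/
def IsVariant (C C' : Clause L) : Prop :=
  ∃ π : Equiv.Perm ℕ, C' = Clause.subst C fun x => FirstOrder.Language.Term.var (π x)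

/-- Merging of repeated occurrences of the same literal. -/
def Clause.merge (C : Clause L) : Clause L :=
  haveI := Classical.decEq (Lit L)
  C.dedup

/-- A clause is a tautology if it contains a complementary pair of literals. -/
def IsTautology (C : Clause L) : Prop := ∃ A : Atom L, Lit.pos A ∈ C ∧ Lit.neg A ∈ C

/-! ### Semantics -/

/-- Truth of a literal in a structure under an assignment. -/
def Lit.Holds {M : Type*} [L.Structure M] (w : ℕ → M) : Lit L → Prop
  | .pos A => FirstOrder.Language.Structure.RelMap A.rel fun i => (A.args i).realize w
  | .neg A => ¬ FirstOrder.Language.Structure.RelMap A.rel fun i => (A.args i).realize w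

/-- A set of clauses is satisfiable if some nonempty structure makes every clause true under every
assignment (the variables of a clause are universally quantified). -/
def Satisfiable (N : Set (Clause L)) : Prop :=
  ∃ (M : Type (max u v)) (_ : Nonempty M) (_ : L.Structure M),
    ∀ C ∈ N, ∀ w : ℕ → M, ∃ l ∈ C, Lit.Holds w l

/-! ### Loosely guarded clauses -/

/-- `IsSubterm s t`: the term `s` occurs in `t`. -/
inductive IsSubterm {L' : FirstOrder.Language.{u, v}} (s : L'.Term ℕ) : L'.Term ℕ → Prop
  | refl : IsSubterm s s
  | arg {n : ℕ} (f : L'.Functions n) (ts : Fin n → L'.Term ℕ) (i : Fin n) :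
      IsSubterm s (ts i) → IsSubterm s (FirstOrder.Language.Term.func f ts)

/-- The list of arguments of a term (empty for variables and constants). -/
def argList : L.Term ℕ → List (L.Term ℕ)
  | .var _ => []
  | .func _ ts => List.ofFn ts

/-- A compound term: neither a variable nor a constant. -/
def IsCompound (t : L.Term ℕ) : Prop := argList t ≠ []

/-- A flat compound term: all its arguments are variables or constants. -/
def IsFlatCompound (t : L.Term ℕ) : Prop := IsCompound t ∧ ∀ s ∈ argList t, ¬ IsCompound s

/-- The depth of a term. -/
def depth : L.Term ℕ → ℕ
  | .var _ => 0
  | .func (l := n) _ ts => if n = 0 then 0 else 1 + Finset.univ.sup fun i => depth (ts i)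

/-- A flat literal: all its arguments are variables or constants. A literal that is not flat
contains a compound term, and is called a compound-term literal. -/
def Lit.IsFlat (l : Lit L) : Prop := ∀ i, ¬ IsCompound (l.atom.args i)

/-- The term `t` occurs (at any depth) in the clause `C`. -/
def Clause.HasTerm (C : Clause L) (t : L.Term ℕ) : Prop :=
  ∃ l ∈ C, ∃ i, IsSubterm t (l.atom.args i)

/-- A simple clause: every argument of a literal is a variable, a constant or a flat compound
term. -/
def IsSimple (C : Clause L) : Prop :=
  ∀ l ∈ C, ∀ i, ¬ IsCompound (l.atom.args i) ∨ IsFlatCompound (l.atom.args i)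

/-- A covering clause: every compound term contains all variables of the clause. -/
def IsCovering (C : Clause L) : Prop :=
  ∀ t, Clause.HasTerm C t → IsCompound t → t.varFinset = Clause.vars C

/-- A strongly compatible clause: any two compound terms have the same argument list. -/
def IsStronglyCompatible (C : Clause L) : Prop :=
  ∀ s t, Clause.HasTerm C s → Clause.HasTerm C t → IsCompound s → IsCompound t →
    argList s = argList t

/-- The negative flat literals form a loose guard: any two variables occur together in one of
them. For `x = y` this says that every variable occurs in a negative flat literal, which matters
for clauses with exactly one variable. -/
def HasLooseGuard (C : Clause L) : Prop :=
  ∀ x ∈ Clause.vars C, ∀ y ∈ Clause.vars C,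
    ∃ l ∈ C, l.IsNeg ∧ l.IsFlat ∧ x ∈ l.vars ∧ y ∈ l.vars

/-- Loosely guarded clauses (the class LG). -/
def IsLG (C : Clause L) : Prop :=
  IsSimple C ∧ IsCovering C ∧ IsStronglyCompatible C ∧ (Clause.IsGround C ∨ HasLooseGuard C)

/-! ### The ordering -/

/-- Function symbols and predicate symbols in one language, so that atoms are terms as well. -/
def exprLang (L : FirstOrder.Language.{u, v}) : FirstOrder.Language.{max u v, 0} :=
  ⟨fun n => L.Functions n ⊕ L.Relations n, fun _ => Empty⟩

/-- The symbols of a signature: constants, function symbols and predicate symbols. -/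
abbrev Sym (L : FirstOrder.Language.{u, v}) := Σ n, (exprLang L).Functions n

/-- A constant or function symbol as a symbol. -/
def Sym.ofFun {n : ℕ} (f : L.Functions n) : Sym L := ⟨n, Sum.inl f⟩

/-- A predicate symbol as a symbol. -/
def Sym.ofRel {n : ℕ} (p : L.Relations n) : Sym L := ⟨n, Sum.inr p⟩

/-- Terms as expressions. -/
def termExpr : L.Term ℕ → (exprLang L).Term ℕ
  | .var x => .var x
  | .func f ts => .func (L := exprLang L) (Sum.inl f) fun i => termExpr (ts i)

/-- Atoms as expressions. -/
def Atom.expr (A : Atom L) : (exprLang L).Term ℕ :=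
  .func (L := exprLang L) (Sum.inr A.rel) fun i => termExpr (A.args i)

/-- The symbols that occur in a clause. -/
def Clause.syms (C : Clause L) : Set (Sym L) :=
  {s | ∃ l ∈ C, ∃ ts, IsSubterm (FirstOrder.Language.Term.func s.2 ts) l.atom.expr}

/-- A precedence (`gt s t`: `s` is larger than `t`): a strict total well-founded ordering of the
symbols in which function symbols are larger than constants, and constants are larger than
predicate symbols. -/
structure Precedence (L : FirstOrder.Language.{u, v}) where
  gt : Sym L → Sym L → Prop
  irrefl : ∀ s, ¬ gt s s
  trans : ∀ r s t, gt r s → gt s t → gt r t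
  total : ∀ s t, s ≠ t → gt s t ∨ gt t s
  wf : WellFounded fun s t => gt t s
  fun_gt_const : ∀ {n : ℕ} (f : L.Functions (n + 1)) (c : L.Functions 0),
    gt (Sym.ofFun f) (Sym.ofFun c)
  const_gt_pred : ∀ (c : L.Functions 0) {n : ℕ} (p : L.Relations n),
    gt (Sym.ofFun c) (Sym.ofRel p)

/-- The lexicographic path ordering of expressions (`LPO gt s t`: `s` is larger than `t`). -/
inductive LPO {L' : FirstOrder.Language.{u, v}} (gt : (Σ n, L'.Functions n) → (Σ n, L'.Functions n) → Prop) :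
    L'.Term ℕ → L'.Term ℕ → Prop
  | arg {n : ℕ} (f : L'.Functions n) (ts : Fin n → L'.Term ℕ) (i : Fin n) :
      LPO gt (.func f ts) (ts i)
  | arg_gt {n : ℕ} (f : L'.Functions n) (ts : Fin n → L'.Term ℕ) (i : Fin n) (s : L'.Term ℕ) :
      LPO gt (ts i) s → LPO gt (.func f ts) s
  | head {n m : ℕ} (f : L'.Functions n) (ts : Fin n → L'.Term ℕ)
      (g : L'.Functions m) (ss : Fin m → L'.Term ℕ) :
      gt ⟨n, f⟩ ⟨m, g⟩ → (∀ j, LPO gt (.func f ts) (ss j)) → LPO gt (.func f ts) (.func g ss)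
  | lex {n : ℕ} (f : L'.Functions n) (ts ss : Fin n → L'.Term ℕ) (i : Fin n) :
      (∀ j, j < i → ts j = ss j) → LPO gt (ts i) (ss i) →
      (∀ j, LPO gt (.func f ts) (ss j)) → LPO gt (.func f ts) (.func f ss)

/-- The ordering of literals: the atoms are compared by the lexicographic path ordering, and
`¬ A` is the next larger literal after `A`. -/
def Precedence.LitGT (P : Precedence L) (l l' : Lit L) : Prop :=
  LPO P.gt l.atom.expr l'.atom.expr ∨ (l.atom = l'.atom ∧ l.IsNeg ∧ ¬ l'.IsNeg)

/-- A ground substitution: all variables are replaced by variable-free terms. -/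
def IsGroundSub (τ : Sub L) : Prop := ∀ x, (τ x).varFinset = ∅

/-- The literal `l` is maximal with respect to `D`: in some ground instance it is at least as large
as all literals of `D`. -/
def Precedence.IsMax (P : Precedence L) (l : Lit L) (D : Clause L) : Prop :=
  ∃ τ : Sub L, IsGroundSub τ ∧
    ∀ l' ∈ D, l.subst τ = l'.subst τ ∨ P.LitGT (l.subst τ) (l'.subst τ)

/-- The literal `l` is strictly maximal with respect to `D`: in some ground instance it is larger
than all literals of `D`. -/
def Precedence.IsStrictMax (P : Precedence L) (l : Lit L) (D : Clause L) : Prop :=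
  ∃ τ : Sub L, IsGroundSub τ ∧ ∀ l' ∈ D, P.LitGT (l.subst τ) (l'.subst τ)

/-- Maximality can be tested before the unifier is applied to the premises (a priori) or
afterwards (a posteriori). -/
inductive Eligibility
  | aPriori
  | aPosteriori

/-- The substitution under which maximality is tested, for an inference with unifier `σ`. -/
def Eligibility.under (e : Eligibility) (σ : Sub L) : Sub L :=
  match e with
  | .aPriori => FirstOrder.Language.Term.var
  | .aPosteriori => σ

/-! ### Selection -/

/-- A function that picks one negative compound-term literal in every non-ground clause that has
one. -/
structure SelectNC (L : FirstOrder.Language.{u, v}) where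
  pick : Clause L → Lit L
  spec : ∀ C : Clause L, ¬ Clause.IsGround C → (∃ l ∈ C, l.IsNeg ∧ ¬ l.IsFlat) →
    pick C ∈ C ∧ (pick C).IsNeg ∧ ¬ (pick C).IsFlat

open Classical in
/-- The selected literals of a clause. Nothing is selected in a ground clause. In a non-ground
clause, one negative compound-term literal is selected if there is one; otherwise nothing if there
is a positive compound-term literal; otherwise (non-ground flat clauses) all negative literals. -/
def SelectNC.selected (sel : SelectNC L) (C : Clause L) : Clause L :=
  if Clause.IsGround C then 0
  else if ∃ l ∈ C, l.IsNeg ∧ ¬ l.IsFlat then {sel.pick C}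
  else if ∃ l ∈ C, ¬ l.IsNeg ∧ ¬ l.IsFlat then 0
  else C.filter fun l => l.IsNeg

/-! ### Inference rules -/

/-- `σ` unifies `A i` with `B i` simultaneously for all `i ∈ S`. -/
def IsUnifier {ι : Type*} (A B : ι → Atom L) (S : Set ι) (σ : Sub L) : Prop :=
  ∀ i ∈ S, (A i).subst σ = (B i).subst σ

/-- `σ` is a most general simultaneous unifier of `A i` and `B i` for `i ∈ S`. -/
def IsMGU {ι : Type*} (A B : ι → Atom L) (S : Set ι) (σ : Sub L) : Prop :=
  IsUnifier A B S σ ∧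
    ∀ θ : Sub L, IsUnifier A B S θ → ∃ η : Sub L, ∀ x, θ x = (σ x).subst η

/-- Given the unifier `σ'` of all pairs, `x` is a top variable of the atoms `A i`: its image has
the greatest depth among the images of the variables of these atoms. -/
def IsTopVariable {n : ℕ} (A : Fin n → Atom L) (σ' : Sub L) (x : ℕ) : Prop :=
  (∃ i, x ∈ (A i).vars) ∧ ∀ i, ∀ y ∈ (A i).vars, depth (σ' y) ≤ depth (σ' x)

/-- The side premise `B ∨ D` has nothing selected, and `B` is strictly maximal with respect to
`D`, tested under the substitution `ρ`. -/
def IsSide (P : Precedence L) (sel : SelectNC L) (ρ : Sub L) (B : Atom L) (D : Clause L) : Prop :=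
  sel.selected (Lit.pos B ::ₘ D) = 0 ∧
    P.IsStrictMax (Lit.pos (B.subst ρ)) (Clause.subst D ρ)

/-- The positive factoring rule: from `C ∨ A₁ ∨ A₂` derive `(C ∨ A₁)σ`. -/
inductive Factor (P : Precedence L) (sel : SelectNC L) (e : Eligibility) :
    Clause L → Clause L → Prop
  | intro (C : Clause L) (A₁ A₂ : Atom L) (σ : Sub L) :
      sel.selected (Lit.pos A₁ ::ₘ Lit.pos A₂ ::ₘ C) = 0 →
      P.IsMax (Lit.pos (A₁.subst (e.under σ))) (Clause.subst C (e.under σ)) →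
      IsMGU (fun _ : Unit => A₁) (fun _ => A₂) Set.univ σ →
      Factor P sel e (Lit.pos A₁ ::ₘ Lit.pos A₂ ::ₘ C) (Clause.subst (Lit.pos A₁ ::ₘ C) σ)

/-- The top-variable resolution rule: `TRes P sel e sides S main R` says that `R` is derived from
the side premises `sides` and the main premise `main`, where the side premises with index in `S`
are the ones resolved upon. All premises are variable-disjoint. -/
inductive TRes (P : Precedence L) (sel : SelectNC L) (e : Eligibility) :
    {n : ℕ} → (Fin n → Clause L) → Finset (Fin n) → Clause L → Clause L → Prop
  /-- Binary resolution of `B ∨ E` and `¬ A ∨ D` upon the only selected literal `¬ A`, or upon a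
  maximal literal `¬ A` if nothing is selected. -/
  | binary (A B : Atom L) (E D : Clause L) (σ : Sub L) :
      Disjoint (Clause.vars (Lit.pos B ::ₘ E)) (Clause.vars (Lit.neg A ::ₘ D)) →
      IsMGU (fun _ : Unit => A) (fun _ => B) Set.univ σ →
      IsSide P sel (e.under σ) B E →
      (sel.selected (Lit.neg A ::ₘ D) = {Lit.neg A} ∨
        (sel.selected (Lit.neg A ::ₘ D) = 0 ∧
          P.IsMax (Lit.neg (A.subst (e.under σ))) (Clause.subst D (e.under σ)))) →
      TRes P sel e (fun _ : Fin 1 => Lit.pos B ::ₘ E) Finset.univ (Lit.neg A ::ₘ D)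
        (Clause.subst (E + D) σ)
  /-- The selected literals of the main premise are `¬ A₁, …, ¬ Aₙ`, and they can be resolved
  simultaneously with the side premises `Bᵢ ∨ Eᵢ` by the unifier `σ'`. Only the literals that
  contain a top variable, those with index in `S`, are resolved, by the unifier `σ`. -/
  | topVariable {n : ℕ} (A B : Fin n → Atom L) (E : Fin n → Clause L) (D : Clause L)
      (σ' σ : Sub L) (S : Finset (Fin n)) :
      (∀ i j, i ≠ j →
        Disjoint (Clause.vars (Lit.pos (B i) ::ₘ E i)) (Clause.vars (Lit.pos (B j) ::ₘ E j))) →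
      (∀ i, Disjoint (Clause.vars (Lit.pos (B i) ::ₘ E i))
        (Clause.vars (Finset.univ.val.map (fun i => Lit.neg (A i)) + D))) →
      sel.selected (Finset.univ.val.map (fun i => Lit.neg (A i)) + D) =
        Finset.univ.val.map (fun i => Lit.neg (A i)) →
      IsMGU A B Set.univ σ' →
      (∀ i, IsSide P sel (e.under σ') (B i) (E i)) →
      (∀ i, i ∈ S ↔ ∃ x ∈ (A i).vars, IsTopVariable A σ' x) →
      S.Nonempty →
      IsMGU A B S σ →
      (∀ i, IsSide P sel (e.under σ) (B i) (E i)) →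
      TRes P sel e (fun i => Lit.pos (B i) ::ₘ E i) S
        (Finset.univ.val.map (fun i => Lit.neg (A i)) + D)
        (Clause.subst ((∑ i ∈ S, E i) + (Sᶜ).val.map (fun i => Lit.neg (A i)) + D) σ)

/-! ### The system -/

/-- `R` is the conclusion of a factoring or resolution inference whose premises are variants of
clauses in `N`. -/
inductive Infers (P : Precedence L) (sel : SelectNC L) (e : Eligibility) (N : Set (Clause L)) :
    Clause L → Prop
  | factor (C C' R : Clause L) : C ∈ N → IsVariant C C' → Factor P sel e C' R → Infers P sel e N R
  | tres {n : ℕ} (sides : Fin n → Clause L) (S : Finset (Fin n)) (main R : Clause L) :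
      (∀ i, ∃ C ∈ N, IsVariant C (sides i)) → (∃ C ∈ N, IsVariant C main) →
      TRes P sel e sides S main R → Infers P sel e N R

/-- A clause that is deleted in the presence of `N`: a tautology or a variant of a clause
in `N`. -/
def Deletable (N : Set (Clause L)) (C : Clause L) : Prop :=
  IsTautology C ∨ ∃ C' ∈ N, IsVariant C' C

/-- One step of a derivation. Repeated literals in conclusions are merged, and a conclusion that
would be deleted at once is not added. -/
inductive Step (P : Precedence L) (sel : SelectNC L) (e : Eligibility) :
    Set (Clause L) → Set (Clause L) → Prop
  | deduce (N : Set (Clause L)) (R : Clause L) : Infers P sel e N R →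
      ¬ Deletable N (Clause.merge R) → Step P sel e N (insert (Clause.merge R) N)
  | delete (N : Set (Clause L)) (C : Clause L) : C ∉ N → Deletable N C →
      Step P sel e (insert C N) N

/-- A derivation of finite length from `N` to `M`. -/
def Derives (P : Precedence L) (sel : SelectNC L) (e : Eligibility) (N M : Set (Clause L)) : Prop :=
  Relation.ReflTransGen (Step P sel e) N M

/-- A saturated set: each conclusion is, after merging of repeated literals, a tautology or a
variant of a clause of the set. -/
def Saturated (P : Precedence L) (sel : SelectNC L) (e : Eligibility) (N : Set (Clause L)) : Prop :=
  ∀ R, Infers P sel e N R → Deletable N (Clause.merge R)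

end TopVar

end

open TopVar

/-!
# Deciding the loosely guarded clauses by top-variable resolution

**Preservation of the class.** In a loosely guarded clause all compound terms have one argument
list, its *frame*, which consists of constants and all the variables of the clause (`Framed`).
A side premise is either flat and ground, or its strictly maximal atom is a compound-term atom,
because a compound term dominates all flat atoms over its variables (`Precedence.lpo_of_flat`).
In every inference the unifier maps the frames of the premises to a single list `W`. If the literal
resolved upon is compound, this is because otherwise two variables would each be mapped to a proper
subterm of the image of the other (`Framed.map_eq_map`). If the main premise is flat, it is because
top variables can only be matched with compound terms, and any two of them occur together in some
literal that is resolved upon (`exists_common_frame`). Once this is known, cutting off the terms in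
the range of the unifier below the arguments of `W` gives another unifier, so a *most general*
unifier maps each variable to a variable, a constant or a flat compound term with argument list `W`
(`IsMGU.shaped`). Hence the conclusion is again framed, the guard of a side premise guards it, and
it is no wider than that premise (`isLG_subst`, `isLG_factor`, `isLG_tres`).

**Termination.** Similarly, a most general unifier introduces no new symbols
(`IsMGU.symsOf_subset`). So, up to variants, there are finitely many clauses without repeated
literals that can be derived. A deduction step makes one of these represented for the first time,
and a deletion step keeps the represented ones (apart from tautologies) and makes the set smaller:
a lexicographic measure decreases (`Step.measure_lt`).

**Completeness.** For a saturated set without the empty clause, the Bachmair–Ganzinger candidate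
model (`candidate`) is a model: a minimal false ground instance of a clause would be the main
premise of an inference with a smaller false instance of the conclusion (`candidate_satisfies`).
This needs only that *some* of the selected literals are resolved, so the restriction to top
variables is harmless. The ingredients are the well-foundedness and the totality on ground terms of
the path ordering (`LPO.wellFounded`, `LPO.total`), the existence of most general unifiers
(`exists_mgu`), and the renaming apart of the premises (`exists_side_premises`).
-/

noncomputable section

namespace TopVar

open FirstOrder.Language

/-! ### Terms and substitutions -/

section Terms

variable {L : FirstOrder.Language.{u, v}}

theorem subst_congr {t : L.Term ℕ} {σ τ : Sub L} (h : ∀ x ∈ t.varFinset, σ x = τ x) :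
    t.subst σ = t.subst τ := by
  induction t with
  | var x => exact h x (by simp)
  | func f ts ih =>
    simp only [Term.subst, Term.func.injEq, heq_eq_eq, true_and]
    funext i
    refine ih i fun x hx => h x ?_
    simp only [Term.varFinset, Finset.mem_biUnion]
    exact ⟨i, Finset.mem_univ i, hx⟩

@[simp]
theorem subst_var (t : L.Term ℕ) : t.subst (Term.var : Sub L) = t := by
  induction t with
  | var x => rfl
  | func f ts ih => simp [Term.subst, ih]

theorem subst_subst (t : L.Term ℕ) (σ τ : Sub L) :
    (t.subst σ).subst τ = t.subst fun x => (σ x).subst τ := by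
  induction t with
  | var x => rfl
  | func f ts ih => simp [Term.subst, ih]

theorem mem_varFinset_subst {t : L.Term ℕ} {σ : Sub L} {x : ℕ} :
    x ∈ (t.subst σ).varFinset ↔ ∃ y ∈ t.varFinset, x ∈ (σ y).varFinset := by
  induction t with
  | var y => simp [Term.subst]
  | func f ts ih =>
    simp only [Term.subst, Term.varFinset, Finset.mem_biUnion, Finset.mem_univ, true_and, ih]
    exact ⟨fun ⟨i, y, hy, hx⟩ => ⟨y, ⟨i, hy⟩, hx⟩, fun ⟨y, ⟨i, hy⟩, hx⟩ => ⟨i, y, hy, hx⟩⟩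

theorem subst_of_ground {t : L.Term ℕ} (h : t.varFinset = ∅) (σ : Sub L) : t.subst σ = t := by
  conv_rhs => rw [← subst_var t]
  exact subst_congr (by simp [h])

/-! ### Compound terms -/

theorem isCompound_func {n : ℕ} {f : L.Functions n} {ts : Fin n → L.Term ℕ} :
    IsCompound (.func f ts) ↔ n ≠ 0 := by
  simp [IsCompound, argList]

@[simp]
theorem not_isCompound_var (x : ℕ) : ¬ IsCompound (.var x : L.Term ℕ) := by
  simp [IsCompound, argList]

theorem argList_subst {t : L.Term ℕ} (h : IsCompound t) (σ : Sub L) :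
    argList (t.subst σ) = (argList t).map fun s => s.subst σ := by
  cases t with
  | var x => simp at h
  | func f ts => simp [Term.subst, argList, List.map_ofFn, Function.comp_def]

theorem IsCompound.subst {t : L.Term ℕ} (h : IsCompound t) (σ : Sub L) :
    IsCompound (t.subst σ) := by
  unfold IsCompound
  rw [argList_subst h]
  exact fun h' => h (List.map_eq_nil_iff.1 h')

theorem argList_eq_nil {t : L.Term ℕ} : argList t = [] ↔ ¬ IsCompound t := by
  simp [IsCompound]

theorem mem_varFinset_iff_argList {t : L.Term ℕ} (h : IsCompound t) {x : ℕ} :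
    x ∈ t.varFinset ↔ ∃ s ∈ argList t, x ∈ s.varFinset := by
  cases t with
  | var x => simp at h
  | func f ts => simp [argList, List.mem_ofFn]

theorem depth_lt_of_mem_argList {s t : L.Term ℕ} (h : s ∈ argList t) : depth s < depth t := by
  cases t with
  | var x => simp [argList] at h
  | @func n f ts =>
    simp only [argList, List.mem_ofFn] at h
    obtain ⟨i, rfl⟩ := h
    have hn : n ≠ 0 := fun h => (h ▸ i).elim0
    have := Finset.le_sup (f := fun i => depth (ts i)) (Finset.mem_univ i)
    simp only [depth, hn, if_false]
    omega

theorem depth_le_of_mem_varFinset {t : L.Term ℕ} {σ : Sub L} {x : ℕ} (h : x ∈ t.varFinset) :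
    depth (σ x) ≤ depth (t.subst σ) := by
  induction t with
  | var y => simp only [Term.varFinset, Finset.mem_singleton] at h; subst h; rfl
  | func f ts ih =>
    simp only [Term.varFinset, Finset.mem_biUnion, Finset.mem_univ, true_and] at h
    obtain ⟨i, hi⟩ := h
    refine (ih i hi).trans (depth_lt_of_mem_argList ?_).le
    simp only [Term.subst, argList, List.mem_ofFn]
    exact ⟨i, rfl⟩

/-- The occurs check: a term that properly contains a variable is deeper than that variable under
every substitution. -/
theorem depth_lt_of_mem_varFinset {t : L.Term ℕ} {σ : Sub L} {x : ℕ} (h : x ∈ t.varFinset)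
    (ht : t ≠ .var x) : depth (σ x) < depth (t.subst σ) := by
  cases t with
  | var y => simp only [Term.varFinset, Finset.mem_singleton] at h; subst h; exact absurd rfl ht
  | func f ts =>
    simp only [Term.varFinset, Finset.mem_biUnion, Finset.mem_univ, true_and] at h
    obtain ⟨i, hi⟩ := h
    refine (depth_le_of_mem_varFinset hi).trans_lt (depth_lt_of_mem_argList ?_)
    simp only [Term.subst, argList, List.mem_ofFn]
    exact ⟨i, rfl⟩

theorem depth_eq_zero {t : L.Term ℕ} (h : ¬ IsCompound t) : depth t = 0 := by
  cases t with
  | var x => rfl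
  | func f ts =>
    rw [isCompound_func, not_not] at h
    simp [depth, h]

theorem depth_pos {t : L.Term ℕ} (h : IsCompound t) : 0 < depth t := by
  cases t with
  | var x => simp at h
  | func f ts =>
    rw [isCompound_func] at h
    simp [depth, h]

/-- A term that is not compound is a variable or is invariant under all substitutions. -/
theorem eq_var_or_const {t : L.Term ℕ} (h : ¬ IsCompound t) :
    (∃ x, t = .var x) ∨ ∃ c : L.Functions 0, t = .func c Fin.elim0 := by
  cases t with
  | var x => exact .inl ⟨x, rfl⟩
  | func f ts =>
    rw [isCompound_func, not_not] at h
    subst h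
    exact .inr ⟨f, by congr; funext i; exact i.elim0⟩

theorem eq_var_of_mem_varFinset {t : L.Term ℕ} (h : ¬ IsCompound t) {x : ℕ}
    (hx : x ∈ t.varFinset) : t = .var x := by
  rcases eq_var_or_const h with ⟨y, rfl⟩ | ⟨c, rfl⟩
  · simp only [Term.varFinset, Finset.mem_singleton] at hx; rw [hx]
  · simp at hx

theorem card_varFinset_le_one {t : L.Term ℕ} (h : ¬ IsCompound t) : t.varFinset.card ≤ 1 := by
  rcases eq_var_or_const h with ⟨y, rfl⟩ | ⟨c, rfl⟩ <;> simp

theorem not_isCompound_subst {t : L.Term ℕ} (h : ¬ IsCompound t) {σ : Sub L}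
    (hσ : ∀ x ∈ t.varFinset, ¬ IsCompound (σ x)) : ¬ IsCompound (t.subst σ) := by
  rcases eq_var_or_const h with ⟨y, rfl⟩ | ⟨c, rfl⟩
  · exact hσ y (by simp)
  · simp [Term.subst, isCompound_func]

theorem isSubterm_cases {s t : L.Term ℕ} (h : IsSubterm s t) :
    s = t ∨ ∃ r ∈ argList t, IsSubterm s r := by
  cases h with
  | refl => exact .inl rfl
  | arg f ts i h => exact .inr ⟨ts i, by simp [argList, List.mem_ofFn], h⟩

theorem eq_of_isSubterm_of_not_isCompound {s t : L.Term ℕ} (h : IsSubterm s t)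
    (ht : ¬ IsCompound t) : s = t := by
  rcases isSubterm_cases h with h | ⟨r, hr, -⟩
  · exact h
  · rw [argList_eq_nil.2 ht] at hr; simp at hr

/-! ### Atoms, literals and clauses -/

theorem Atom.mem_vars {A : Atom L} {x : ℕ} : x ∈ A.vars ↔ ∃ i, x ∈ (A.args i).varFinset := by
  simp [Atom.vars]

theorem Clause.mem_vars {C : Clause L} {x : ℕ} : x ∈ Clause.vars C ↔ ∃ l ∈ C, x ∈ l.vars := by
  unfold Clause.vars
  induction C using Multiset.induction_on with
  | empty => simp
  | cons a s ih => simp [ih]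

@[simp]
theorem Lit.atom_subst (l : Lit L) (σ : Sub L) : (l.subst σ).atom = l.atom.subst σ := by
  cases l <;> rfl

@[simp]
theorem Lit.isNeg_subst (l : Lit L) (σ : Sub L) : (l.subst σ).IsNeg ↔ l.IsNeg := by
  cases l <;> rfl

theorem Lit.ext' {l l' : Lit L} (h : l.atom = l'.atom) (h' : l.IsNeg ↔ l'.IsNeg) : l = l' := by
  cases l <;> cases l' <;> simp_all [Lit.atom, Lit.IsNeg]

theorem Lit.eq_neg {l : Lit L} (h : l.IsNeg) : l = .neg l.atom := by
  cases l
  · exact h.elim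
  · rfl

theorem Atom.mem_vars_subst {A : Atom L} {σ : Sub L} {x : ℕ} :
    x ∈ (A.subst σ).vars ↔ ∃ y ∈ A.vars, x ∈ (σ y).varFinset := by
  simp only [Atom.mem_vars, Atom.subst, mem_varFinset_subst]
  exact ⟨fun ⟨i, y, hy, h⟩ => ⟨y, ⟨i, hy⟩, h⟩, fun ⟨y, ⟨i, hy⟩, h⟩ => ⟨i, y, hy, h⟩⟩

theorem Lit.mem_vars_subst {l : Lit L} {σ : Sub L} {x : ℕ} :
    x ∈ (l.subst σ).vars ↔ ∃ y ∈ l.vars, x ∈ (σ y).varFinset := by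
  simp only [Lit.vars, Lit.atom_subst, Atom.mem_vars_subst]

theorem Clause.mem_subst {C : Clause L} {σ : Sub L} {l : Lit L} :
    l ∈ Clause.subst C σ ↔ ∃ l' ∈ C, l'.subst σ = l := by
  simp [Clause.subst]

theorem Clause.mem_vars_subst {C : Clause L} {σ : Sub L} {x : ℕ} :
    x ∈ Clause.vars (Clause.subst C σ) ↔ ∃ y ∈ Clause.vars C, x ∈ (σ y).varFinset := by
  simp only [Clause.mem_vars, Clause.mem_subst]
  constructor
  · rintro ⟨_, ⟨l, hl, rfl⟩, h⟩
    obtain ⟨y, hy, h⟩ := Lit.mem_vars_subst.1 h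
    exact ⟨y, ⟨l, hl, hy⟩, h⟩
  · rintro ⟨y, ⟨l, hl, hy⟩, h⟩
    exact ⟨_, ⟨l, hl, rfl⟩, Lit.mem_vars_subst.2 ⟨y, hy, h⟩⟩

theorem Atom.subst_congr {A : Atom L} {σ τ : Sub L} (h : ∀ x ∈ A.vars, σ x = τ x) :
    A.subst σ = A.subst τ := by
  simp only [Atom.subst, Atom.mk.injEq, heq_eq_eq, true_and]
  funext i
  exact TopVar.subst_congr fun x hx => h x (Atom.mem_vars.2 ⟨i, hx⟩)

theorem Lit.subst_congr {l : Lit L} {σ τ : Sub L} (h : ∀ x ∈ l.vars, σ x = τ x) :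
    l.subst σ = l.subst τ := by
  cases l <;> simp only [Lit.subst, Lit.pos.injEq, Lit.neg.injEq] <;> exact Atom.subst_congr h

theorem Atom.subst_subst (A : Atom L) (σ τ : Sub L) :
    (A.subst σ).subst τ = A.subst fun x => (σ x).subst τ := by
  simp [Atom.subst, TopVar.subst_subst]

theorem Lit.subst_subst (l : Lit L) (σ τ : Sub L) :
    (l.subst σ).subst τ = l.subst fun x => (σ x).subst τ := by
  cases l <;> simp [Lit.subst, Atom.subst_subst]

theorem Clause.subst_subst (C : Clause L) (σ τ : Sub L) :
    Clause.subst (Clause.subst C σ) τ = Clause.subst C fun x => (σ x).subst τ := by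
  simp [Clause.subst, Lit.subst_subst]

@[simp]
theorem Atom.subst_var (A : Atom L) : A.subst (Term.var : Sub L) = A := by
  simp [Atom.subst]

@[simp]
theorem Lit.subst_var (l : Lit L) : l.subst (Term.var : Sub L) = l := by
  cases l <;> simp [Lit.subst]

@[simp]
theorem Clause.subst_var (C : Clause L) : Clause.subst C (Term.var : Sub L) = C := by
  simp [Clause.subst]

@[simp]
theorem Clause.subst_add (C D : Clause L) (σ : Sub L) :
    Clause.subst (C + D) σ = Clause.subst C σ + Clause.subst D σ := by
  simp [Clause.subst]

@[simp]
theorem Clause.subst_cons (l : Lit L) (C : Clause L) (σ : Sub L) :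
    Clause.subst (l ::ₘ C) σ = l.subst σ ::ₘ Clause.subst C σ := by
  simp [Clause.subst]

theorem Clause.mem_merge {C : Clause L} {l : Lit L} : l ∈ Clause.merge C ↔ l ∈ C := by
  simp [Clause.merge]

theorem Clause.merge_le (C : Clause L) : Clause.merge C ≤ C := by
  exact @Multiset.dedup_le _ (Classical.decEq _) C

theorem Clause.nodup_merge (C : Clause L) : (Clause.merge C).Nodup := by
  exact @Multiset.nodup_dedup _ (Classical.decEq _) C

end Terms

/-! ### The lexicographic path ordering -/

section LPO

variable {L' : FirstOrder.Language.{u, v}}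
  {gt : (Σ n, L'.Functions n) → (Σ n, L'.Functions n) → Prop}

theorem LPO.inv {n : ℕ} {f : L'.Functions n} {ts : Fin n → L'.Term ℕ} {u : L'.Term ℕ}
    (h : LPO gt (.func f ts) u) :
    (∃ i, u = ts i ∨ LPO gt (ts i) u) ∨
    (∃ (m : ℕ) (g : L'.Functions m) (ss : Fin m → L'.Term ℕ), u = .func g ss ∧
      gt ⟨n, f⟩ ⟨m, g⟩ ∧ ∀ j, LPO gt (.func f ts) (ss j)) ∨
    (∃ (ss : Fin n → L'.Term ℕ) (i : Fin n), u = .func f ss ∧ (∀ j, j < i → ts j = ss j) ∧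
      LPO gt (ts i) (ss i) ∧ ∀ j, LPO gt (.func f ts) (ss j)) := by
  cases h with
  | arg f ts i => exact .inl ⟨i, .inl rfl⟩
  | arg_gt f ts i s h => exact .inl ⟨i, .inr h⟩
  | head f ts g ss h1 h2 => exact .inr (.inl ⟨_, g, ss, rfl, h1, h2⟩)
  | lex f ts ss i h1 h2 h3 => exact .inr (.inr ⟨ss, i, rfl, h1, h2, h3⟩)

/-- A term whose arguments are accessible is accessible. The outer inductions are on the head
symbol and, lexicographically, on the tuple of (accessible) arguments; the inner one is on the
structure of the smaller term. -/
theorem LPO.acc_func (hwf : WellFounded fun s t => gt t s) (s : Σ n, L'.Functions n)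
    (ts : Fin s.1 → {t : L'.Term ℕ // Acc (fun a b => LPO gt b a) t}) :
    Acc (fun a b => LPO gt b a) (.func s.2 fun i => (ts i).1) := by
  induction s using hwf.induction with
  | _ s ihs =>
  have hlex : WellFounded (Pi.Lex (fun i j : Fin s.1 => i < j)
      (fun {_} (a b : {t : L'.Term ℕ // Acc (fun a b => LPO gt b a) t}) => LPO gt b.1 a.1)) :=
    Pi.Lex.wellFounded _ fun _ => ⟨fun a =>
      InvImage.accessible (fun a : {t : L'.Term ℕ // Acc (fun a b => LPO gt b a) t} => a.1) a.2⟩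
  induction ts using hlex.induction with
  | _ ts iht =>
  refine Acc.intro _ fun u hu => ?_
  induction u with
  | var x =>
    rcases hu.inv with ⟨i, h | h⟩ | ⟨m, g, ss, h, -⟩ | ⟨ss, i, h, -⟩
    · rw [h]; exact (ts i).2
    · exact (ts i).2.inv h
    · cases h
    · cases h
  | func g us ih =>
    rcases hu.inv with ⟨i, h | h⟩ | ⟨m, g', ss, h, h1, h2⟩ | ⟨ss, i, h, h1, h2, h3⟩
    · rw [h]; exact (ts i).2
    · exact (ts i).2.inv h
    · cases h
      exact ihs ⟨_, g⟩ h1 fun j => ⟨_, ih j (h2 j)⟩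
    · cases h
      exact iht (fun j => ⟨_, ih j (h3 j)⟩) ⟨i, fun j hj => Subtype.ext (h1 j hj).symm, h2⟩

theorem LPO.wellFounded (hwf : WellFounded fun s t => gt t s) :
    WellFounded fun a b : L'.Term ℕ => LPO gt b a := by
  refine ⟨fun t => ?_⟩
  induction t with
  | var x => exact Acc.intro _ fun u hu => by cases hu
  | func f ts ih => exact LPO.acc_func hwf ⟨_, f⟩ fun i => ⟨ts i, ih i⟩

theorem LPO.total (htot : ∀ s t, s ≠ t → gt s t ∨ gt t s) (s t : L'.Term ℕ)
    (hs : s.varFinset = ∅) (ht : t.varFinset = ∅) : s = t ∨ LPO gt s t ∨ LPO gt t s := by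
  induction s generalizing t with
  | var x => simp at hs
  | @func n f ss ihs =>
  have hss : ∀ i, (ss i).varFinset = ∅ := fun i =>
    Finset.subset_empty.1 (hs ▸ fun x hx => by
      simp only [Term.varFinset, Finset.mem_biUnion]; exact ⟨i, Finset.mem_univ i, hx⟩)
  induction t with
  | var x => simp at ht
  | @func m g ts iht =>
  have hts : ∀ i, (ts i).varFinset = ∅ := fun i =>
    Finset.subset_empty.1 (ht ▸ fun x hx => by
      simp only [Term.varFinset, Finset.mem_biUnion]; exact ⟨i, Finset.mem_univ i, hx⟩)
  by_cases h1 : ∃ i, ss i = .func g ts ∨ LPO gt (ss i) (.func g ts)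
  · obtain ⟨i, h | h⟩ := h1
    · exact .inr (.inl (h ▸ LPO.arg f ss i))
    · exact .inr (.inl (LPO.arg_gt f ss i _ h))
  by_cases h2 : ∃ j, .func f ss = ts j ∨ LPO gt (ts j) (.func f ss)
  · obtain ⟨j, h | h⟩ := h2
    · exact .inr (.inr (h ▸ LPO.arg g ts j))
    · exact .inr (.inr (LPO.arg_gt g ts j _ h))
  push Not at h1 h2
  have h1' : ∀ i, LPO gt (.func g ts) (ss i) := fun i => by
    rcases ihs i (.func g ts) (hss i) ht with h | h | h
    · exact absurd h (h1 i).1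
    · exact absurd h (h1 i).2
    · exact h
  have h2' : ∀ j, LPO gt (.func f ss) (ts j) := fun j => by
    rcases iht j (hts j) with h | h | h
    · exact absurd h (h2 j).1
    · exact h
    · exact absurd h (h2 j).2
  by_cases hfg : (⟨n, f⟩ : Σ n, L'.Functions n) = ⟨m, g⟩
  · cases hfg
    by_cases he : ss = ts
    · exact .inl (he ▸ rfl)
    -- the first position at which the arguments differ
    obtain ⟨i, hi, hmin⟩ : ∃ i, ss i ≠ ts i ∧ ∀ j < i, ss j = ts j := by
      obtain ⟨i, hi, hmin⟩ := WellFounded.has_min (wellFounded_lt (α := Fin n)) {i | ss i ≠ ts i}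
        (Function.ne_iff.1 he)
      exact ⟨i, hi, fun j hj => by_contra fun h => hmin j h hj⟩
    rcases ihs i (ts i) (hss i) (hts i) with h | h | h
    · exact absurd h hi
    · exact .inr (.inl (LPO.lex f ss ts i hmin h h2'))
    · exact .inr (.inr (LPO.lex f ts ss i (fun j hj => (hmin j hj).symm) h h1'))
  · rcases htot _ _ hfg with h | h
    · exact .inr (.inl (LPO.head f ss g ts h h2'))
    · exact .inr (.inr (LPO.head g ts f ss h h1'))

end LPO

/-! ### Terms and atoms as expressions -/

section Expr

variable {L : FirstOrder.Language.{u, v}}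

@[simp]
theorem varFinset_termExpr (t : L.Term ℕ) : (termExpr t).varFinset = t.varFinset := by
  induction t with
  | var x => rfl
  | func f ts ih => simp [termExpr, ih]

theorem termExpr_subst (t : L.Term ℕ) (σ : Sub L) :
    termExpr (t.subst σ) = (termExpr t).subst fun x => termExpr (σ x) := by
  induction t with
  | var x => rfl
  | func f ts ih => simp [termExpr, Term.subst, ih]

theorem termExpr_injective : Function.Injective (termExpr : L.Term ℕ → _) := by
  intro s t h
  induction s generalizing t with
  | var x =>
    cases t with
    | var y => simpa [termExpr] using h
    | func g ts => simp [termExpr] at h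
  | func f ss ih =>
    cases t with
    | var y => simp [termExpr] at h
    | func g ts =>
      obtain ⟨rfl, h1, h2⟩ := Term.func.inj h
      have h1 := Sum.inl.inj (eq_of_heq h1)
      subst h1
      congr 1
      funext i
      exact ih i (congrFun (eq_of_heq h2) i)

theorem Atom.expr_injective : Function.Injective (Atom.expr : Atom L → _) := by
  rintro ⟨n, p, as⟩ ⟨m, q, bs⟩ h
  obtain ⟨rfl, h1, h2⟩ := Term.func.inj h
  have h1 := Sum.inr.inj (eq_of_heq h1)
  subst h1
  congr 1
  funext i
  exact termExpr_injective (congrFun (eq_of_heq h2) i)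

theorem Atom.varFinset_expr (A : Atom L) : A.expr.varFinset = A.vars := by
  simp [Atom.expr, Atom.vars]

theorem Atom.expr_subst (A : Atom L) (σ : Sub L) :
    (A.subst σ).expr = A.expr.subst fun x => termExpr (σ x) := by
  simp [Atom.expr, Atom.subst, Term.subst, termExpr_subst]

end Expr

/-! ### The ordering of literals -/

section LitOrder

variable {L : FirstOrder.Language.{u, v}} (P : Precedence L)

theorem Precedence.wellFounded_litGT : WellFounded fun l l' : Lit L => P.LitGT l' l := by
  classical
  let φ : Lit L → _ × ℕ := fun l => (l.atom.expr, if l.IsNeg then 1 else 0)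
  refine Subrelation.wf (r := InvImage (Prod.Lex (fun a b => LPO P.gt b a) (· < ·)) φ) ?_
    (InvImage.wf φ (WellFounded.prod_lex (LPO.wellFounded P.wf) wellFounded_lt))
  rintro l l' (h | ⟨h, h1, h2⟩)
  · exact Prod.Lex.left _ _ h
  · simp only [InvImage, φ, h, h1, h2, if_true, if_false]
    exact Prod.Lex.right _ (by norm_num)

theorem Precedence.litGT_asymm {l l' : Lit L} (h : P.LitGT l l') : ¬ P.LitGT l' l :=
  fun h' => P.wellFounded_litGT.asymmetric _ _ h h'

theorem Precedence.litGT_irrefl (l : Lit L) : ¬ P.LitGT l l :=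
  fun h => P.litGT_asymm h h

theorem Precedence.litGT_total {l l' : Lit L} (h : l.vars = ∅) (h' : l'.vars = ∅) :
    l = l' ∨ P.LitGT l l' ∨ P.LitGT l' l := by
  rcases LPO.total P.total l.atom.expr l'.atom.expr (by rwa [Atom.varFinset_expr])
    (by rwa [Atom.varFinset_expr]) with h | h | h
  · have h := Atom.expr_injective h
    by_cases h1 : l.IsNeg <;> by_cases h2 : l'.IsNeg
    · exact .inl (Lit.ext' h (by tauto))
    · exact .inr (.inl (.inr ⟨h, h1, h2⟩))
    · exact .inr (.inr (.inr ⟨h.symm, h2, h1⟩))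
    · exact .inl (Lit.ext' h (by tauto))
  · exact .inr (.inl (.inl h))
  · exact .inr (.inr (.inl h))

/-- The rank of a literal in the well-founded ordering of literals. -/
def Precedence.rank (l : Lit L) : Ordinal.{max u v} := (P.wellFounded_litGT.apply l).rank

theorem Precedence.rank_lt {l l' : Lit L} (h : P.LitGT l l') : P.rank l' < P.rank l :=
  (P.wellFounded_litGT.apply l).rank_lt_of_rel h

theorem lpo_of_mem_varFinset {gt : Sym L → Sym L → Prop} {t : L.Term ℕ} {x : ℕ} (τ : Sub L)
    (hx : x ∈ t.varFinset) (ht : t ≠ .var x) :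
    LPO gt (termExpr (t.subst τ)) (termExpr (τ x)) := by
  induction t with
  | var y => simp only [Term.varFinset, Finset.mem_singleton] at hx; subst hx; exact absurd rfl ht
  | func f ts ih =>
    simp only [Term.varFinset, Finset.mem_biUnion, Finset.mem_univ, true_and] at hx
    obtain ⟨i, hi⟩ := hx
    by_cases h : ts i = .var x
    · have := LPO.arg (gt := gt) (L' := exprLang L) (Sum.inl f)
        (fun i => termExpr ((ts i).subst τ)) i
      rw [h] at this
      exact this
    · exact LPO.arg_gt (L' := exprLang L) (Sum.inl f)
        (fun i => termExpr ((ts i).subst τ)) i _ (ih i hi h)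

variable [Nonempty L.Constants]

/-- Atoms with a compound argument dominate, in every instance, the flat atoms whose variables
occur in that argument. -/
theorem Precedence.lpo_of_flat {A A' : Atom L} {k : Fin A'.arity}
    (hA : ∀ i, ¬ IsCompound (A.args i)) (hk : IsCompound (A'.args k))
    (hv : A.vars ⊆ (A'.args k).varFinset) (τ : Sub L) :
    LPO P.gt (A'.subst τ).expr (A.subst τ).expr := by
  obtain ⟨c⟩ := ‹Nonempty L.Constants›
  refine LPO.arg_gt (L' := exprLang L) _ _ k _ ?_
  change LPO P.gt (termExpr ((A'.args k).subst τ)) _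
  generalize A'.args k = t at hk hv
  cases t with
  | var x => simp at hk
  | @func n f ts =>
  rw [isCompound_func] at hk
  obtain ⟨m, rfl⟩ := Nat.exists_eq_succ_of_ne_zero hk
  refine LPO.head (L' := exprLang L) _ _ _ _
    (P.trans _ (Sym.ofFun c) _ (P.fun_gt_const f c) (P.const_gt_pred c A.rel)) fun i => ?_
  change LPO P.gt (termExpr ((Term.func f ts).subst τ)) (termExpr ((A.args i).subst τ))
  rcases eq_var_or_const (hA i) with ⟨x, hx⟩ | ⟨d, hd⟩
  · rw [hx]
    exact lpo_of_mem_varFinset τ (hv (Atom.mem_vars.2 ⟨i, by simp [hx]⟩)) (by simp)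
  · rw [hd]
    exact LPO.head (L' := exprLang L) _ _ _ _ (P.fun_gt_const f d) fun j => j.elim0

end LitOrder

/-! ### Most general unifiers -/

section Unification

variable {L : FirstOrder.Language.{u, v}}

/-- Two different unifiable terms disagree at some position where one of them has a variable `x`
and the other a term `u` without `x`; every unifier of the terms unifies `x` and `u`. -/
theorem exists_disagreement {s t : L.Term ℕ} (h : s ≠ t) {η : Sub L}
    (hη : s.subst η = t.subst η) :
    ∃ (x : ℕ) (w : L.Term ℕ), x ∈ s.varFinset ∪ t.varFinset ∧ x ∉ w.varFinset ∧
      w.varFinset ⊆ s.varFinset ∪ t.varFinset ∧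
      ∀ θ : Sub L, s.subst θ = t.subst θ → θ x = w.subst θ := by
  induction s generalizing t with
  | var x =>
    refine ⟨x, t, by simp, fun hx => ?_, Finset.subset_union_right, fun θ hθ => hθ⟩
    have := depth_lt_of_mem_varFinset (σ := η) hx h.symm
    rw [← hη] at this
    exact lt_irrefl _ this
  | @func n f ss ih =>
    cases t with
    | var x =>
      refine ⟨x, .func f ss, by simp, fun hx => ?_, Finset.subset_union_left, fun θ hθ => hθ.symm⟩
      have := depth_lt_of_mem_varFinset (σ := η) hx h
      rw [hη] at this
      exact lt_irrefl _ this
    | @func m g ts =>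
      simp only [Term.subst, Term.func.injEq] at hη
      obtain ⟨rfl, h1, h2⟩ := hη
      have h1 := eq_of_heq h1
      subst h1
      have h2 := eq_of_heq h2
      obtain ⟨i, hi⟩ := Function.ne_iff.1 fun h' => h (congrArg _ h')
      obtain ⟨x, w, hx, hw, hv, hθ⟩ := ih i hi (congrFun h2 i)
      have hsub : (ss i).varFinset ∪ (ts i).varFinset ⊆
          (Term.func f ss).varFinset ∪ (Term.func f ts).varFinset :=
        Finset.union_subset_union (Finset.subset_biUnion_of_mem (fun i => (ss i).varFinset)
          (Finset.mem_univ i)) (Finset.subset_biUnion_of_mem (fun i => (ts i).varFinset)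
          (Finset.mem_univ i))
      refine ⟨x, w, hsub hx, hw, hv.trans hsub, fun θ h' => hθ θ ?_⟩
      simp only [Term.subst, Term.func.injEq, heq_eq_eq, true_and] at h'
      exact congrFun h' i

theorem Atom.exists_args_ne {A B : Atom L} (h : A ≠ B) {η : Sub L} (hη : A.subst η = B.subst η) :
    ∃ s t : L.Term ℕ, s ≠ t ∧ s.varFinset ⊆ A.vars ∧ t.varFinset ⊆ B.vars ∧
      ∀ θ : Sub L, A.subst θ = B.subst θ → s.subst θ = t.subst θ := by
  obtain ⟨n, p, as⟩ := A
  obtain ⟨m, q, bs⟩ := B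
  simp only [Atom.subst, Atom.mk.injEq] at hη
  obtain ⟨rfl, h1, -⟩ := hη
  have h1 := eq_of_heq h1
  subst h1
  obtain ⟨i, hi⟩ := Function.ne_iff.1 fun h' : as = bs => h (congrArg _ h')
  refine ⟨as i, bs i, hi, fun x hx => Atom.mem_vars.2 ⟨i, hx⟩,
    fun x hx => Atom.mem_vars.2 ⟨i, hx⟩, fun θ hθ => ?_⟩
  simp only [Atom.subst, Atom.mk.injEq, heq_eq_eq, true_and] at hθ
  exact congrFun hθ i

/-- The invariant of Robinson's algorithm: a substitution through which all unifiers factor can be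
extended to a most general unifier. Each step removes a variable from the instantiated problem. -/
theorem exists_mgu_of_factor {ι : Type*} (A B : ι → Atom L) (S : Finset ι) {θ₀ : Sub L}
    (h₀ : IsUnifier A B (S : Set ι) θ₀) (σ : Sub L)
    (hσ : ∀ θ : Sub L, IsUnifier A B (S : Set ι) θ → ∃ η : Sub L, ∀ x, θ x = (σ x).subst η) :
    ∃ σ' : Sub L, IsMGU A B (S : Set ι) σ' := by
  classical
  induction hn : (S.biUnion fun i => ((A i).subst σ).vars ∪ ((B i).subst σ).vars).card
    using Nat.strong_induction_on generalizing σ with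
  | _ n ih =>
  by_cases hu : IsUnifier A B (S : Set ι) σ
  · exact ⟨σ, hu, hσ⟩
  simp only [IsUnifier, not_forall] at hu
  obtain ⟨i, hi, hne⟩ := hu
  have hfac : ∀ {θ η : Sub L}, (∀ x, θ x = (σ x).subst η) → IsUnifier A B (S : Set ι) θ →
      ((A i).subst σ).subst η = ((B i).subst σ).subst η := by
    intro θ η h hθ
    rw [Atom.subst_subst, Atom.subst_subst, ← funext h]
    exact hθ i hi
  obtain ⟨η₀, hη₀⟩ := hσ θ₀ h₀
  obtain ⟨s, t, hst, hs, ht, hθ⟩ := Atom.exists_args_ne hne (hfac hη₀ h₀)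
  obtain ⟨x, w, hx, hxw, hw, hxη⟩ := exists_disagreement hst (hθ _ (hfac hη₀ h₀))
  let ρ : Sub L := Function.update Term.var x w
  have hρx : ρ x = w := Function.update_self ..
  have hρy : ∀ y, y ≠ x → ρ y = .var y := fun y hy => Function.update_of_ne hy ..
  have hst' : s.varFinset ∪ t.varFinset ⊆
      S.biUnion fun i => ((A i).subst σ).vars ∪ ((B i).subst σ).vars :=
    (Finset.union_subset_union hs ht).trans
      (Finset.subset_biUnion_of_mem (fun i => ((A i).subst σ).vars ∪ ((B i).subst σ).vars) hi)
  -- variables of an instance under `ρ` are old variables other than `x`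
  have hmem : ∀ {V : Finset ℕ} {y z : ℕ}, s.varFinset ∪ t.varFinset ⊆ V → y ∈ V →
      z ∈ (ρ y).varFinset → z ∈ V.erase x := by
    intro V y z hV hy hz
    by_cases hyx : y = x
    · subst hyx
      rw [hρx] at hz
      exact Finset.mem_erase.2 ⟨fun h => hxw (h ▸ hz), hV (hw hz)⟩
    · rw [hρy y hyx] at hz
      simp only [Term.varFinset, Finset.mem_singleton] at hz
      subst hz
      exact Finset.mem_erase.2 ⟨hyx, hy⟩
  refine ih _ ?_ (fun y => (σ y).subst ρ) ?_ rfl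
  · rw [← hn]
    refine (Finset.card_le_card ?_).trans_lt (Finset.card_erase_lt_of_mem (hst' hx))
    intro z hz
    simp only [Finset.mem_biUnion, Finset.mem_union, ← Atom.subst_subst,
      Atom.mem_vars_subst (σ := ρ)] at hz
    obtain ⟨j, hj, ⟨y, hy, hz⟩ | ⟨y, hy, hz⟩⟩ := hz
    · exact hmem hst' (Finset.mem_biUnion.2 ⟨j, hj, Finset.mem_union_left _ hy⟩) hz
    · exact hmem hst' (Finset.mem_biUnion.2 ⟨j, hj, Finset.mem_union_right _ hy⟩) hz
  · intro θ hθu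
    obtain ⟨η, hη⟩ := hσ θ hθu
    refine ⟨η, fun y => ?_⟩
    have hρη : (fun z => (ρ z).subst η) = η := by
      funext z
      by_cases hz : z = x
      · subst hz
        rw [hρx, ← hxη η (hθ _ (hfac hη hθu))]
      · rw [hρy z hz]; rfl
    rw [hη y, subst_subst, hρη]

/-- Every solvable finite unification problem has a most general unifier. -/
theorem exists_mgu {ι : Type*} (A B : ι → Atom L) (S : Finset ι) {θ : Sub L}
    (h : IsUnifier A B (S : Set ι) θ) : ∃ σ : Sub L, IsMGU A B (S : Set ι) σ :=
  exists_mgu_of_factor A B S h Term.var fun θ _ => ⟨θ, fun _ => rfl⟩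

/-- Ground unifiers factor through a most general unifier by a ground substitution. -/
theorem IsMGU.exists_ground [Nonempty L.Constants] {ι : Type*} {A B : ι → Atom L} {S : Set ι}
    {σ θ : Sub L} (hσ : IsMGU A B S σ) (hθ : IsUnifier A B S θ) (hg : IsGroundSub θ) :
    ∃ η : Sub L, IsGroundSub η ∧ ∀ x, θ x = (σ x).subst η := by
  obtain ⟨c⟩ := ‹Nonempty L.Constants›
  obtain ⟨η, hη⟩ := hσ.2 θ hθ
  refine ⟨fun y => if (η y).varFinset = ∅ then η y else .func c Fin.elim0, fun y => ?_,
    fun x => (hη x).trans (subst_congr fun y hy => (if_pos ?_).symm)⟩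
  · dsimp only
    split_ifs with h
    · exact h
    · simp
  · refine Finset.eq_empty_of_forall_notMem fun z hz => ?_
    have := mem_varFinset_subst.2 ⟨y, hy, hz⟩
    rw [← hη x, hg x] at this
    simp at this

end Unification

/-! ### The shape of most general unifiers -/

section Shape

variable {L : FirstOrder.Language.{u, v}}

open Classical in
/-- Compound terms are replaced by a variable. -/
def collapse (t : L.Term ℕ) : L.Term ℕ := if IsCompound t then .var 0 else t

open Classical in
/-- Terms are cut down to variables and constants, except that compound terms with argument list
`W` keep their head symbol. -/
def cut (W : List (L.Term ℕ)) : L.Term ℕ → L.Term ℕ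
  | .var x => .var x
  | .func f ts =>
    if List.ofFn ts = W then .func f fun i => collapse (ts i) else collapse (.func f ts)

/-- If the term `t` is compound, then it is flat and `σ` turns its argument list into `W`. -/
def Conforms (σ : Sub L) (W : List (L.Term ℕ)) (t : L.Term ℕ) : Prop :=
  IsCompound t → (∀ s ∈ argList t, ¬ IsCompound s) ∧ (argList t).map (fun s => s.subst σ) = W

/-- All compound terms in the range of `σ` are flat with argument list `W`. -/
def Shaped (σ : Sub L) (W : List (L.Term ℕ)) : Prop :=
  ∀ x, IsCompound (σ x) → argList (σ x) = W ∧ ∀ s ∈ W, ¬ IsCompound s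

theorem collapse_of_not_isCompound {t : L.Term ℕ} (h : ¬ IsCompound t) : collapse t = t :=
  if_neg h

theorem not_isCompound_collapse (t : L.Term ℕ) : ¬ IsCompound (collapse t) := by
  unfold collapse
  split_ifs with h
  · simp
  · exact h

theorem cut_of_ne {W : List (L.Term ℕ)} {t : L.Term ℕ} (h : argList t ≠ W) :
    cut W t = collapse t := by
  cases t with
  | var x => simp [cut, collapse]
  | func f ts => exact if_neg h

theorem cut_of_not_isCompound {W : List (L.Term ℕ)} {t : L.Term ℕ} (h : ¬ IsCompound t) :
    cut W t = t := by
  rcases eq_var_or_const h with ⟨x, rfl⟩ | ⟨c, rfl⟩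
  · rfl
  · simp only [cut]
    split_ifs
    · congr; funext i; exact i.elim0
    · exact collapse_of_not_isCompound h

theorem argList_ne_of_mem {s : L.Term ℕ} {W : List (L.Term ℕ)} (h : s ∈ W) : argList s ≠ W :=
  fun h' => lt_irrefl _ (depth_lt_of_mem_argList (h' ▸ h : s ∈ argList s))

theorem subst_cut {σ : Sub L} {W : List (L.Term ℕ)} {t : L.Term ℕ} (h : Conforms σ W t) :
    t.subst (fun x => cut W (σ x)) = cut W (t.subst σ) := by
  by_cases hc : IsCompound t
  · obtain ⟨h1, h2⟩ := h hc
    cases t with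
    | var x => simp at hc
    | func f ts =>
      have hW : (List.ofFn fun i => (ts i).subst σ) = W := by
        simpa [argList, List.map_ofFn, Function.comp_def] using h2
      simp only [Term.subst, cut, hW, if_true, Term.func.injEq, heq_eq_eq, true_and]
      funext i
      rcases eq_var_or_const (h1 (ts i) (by simp [argList, List.mem_ofFn])) with ⟨x, hx⟩ | ⟨c, hx⟩
      · rw [hx]
        refine cut_of_ne (argList_ne_of_mem ?_)
        rw [← hW, List.mem_ofFn]
        exact ⟨i, by rw [hx]; rfl⟩
      · have hg : (ts i).varFinset = ∅ := by simp [hx]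
        rw [subst_of_ground hg, subst_of_ground hg, collapse_of_not_isCompound]
        rw [hx, isCompound_func]; simp
  · rcases eq_var_or_const hc with ⟨x, rfl⟩ | ⟨c, rfl⟩
    · rfl
    · rw [subst_of_ground (by simp), subst_of_ground (by simp), cut_of_not_isCompound hc]

/-- Application of a function to the arguments of an atom. -/
def Atom.mapArgs (φ : L.Term ℕ → L.Term ℕ) (A : Atom L) : Atom L :=
  ⟨A.arity, A.rel, fun i => φ (A.args i)⟩

theorem Atom.subst_cut {σ : Sub L} {W : List (L.Term ℕ)} {A : Atom L}
    (h : ∀ i, Conforms σ W (A.args i)) :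
    A.subst (fun x => cut W (σ x)) = (A.subst σ).mapArgs (cut W) := by
  simp only [Atom.subst, Atom.mapArgs, TopVar.subst_cut (h _)]

/-- A unification problem whose compound terms all become terms with argument list `W` also has
the cut unifier. Hence the most general unifier is at most as deep as the cut one. -/
theorem IsMGU.shaped {ι : Type*} {A B : ι → Atom L} {S : Set ι} {σ : Sub L}
    (hσ : IsMGU A B S σ) {W : List (L.Term ℕ)}
    (hA : ∀ i ∈ S, ∀ k, Conforms σ W ((A i).args k))
    (hB : ∀ i ∈ S, ∀ k, Conforms σ W ((B i).args k)) : Shaped σ W := by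
  obtain ⟨η, hη⟩ := hσ.2 (fun x => cut W (σ x)) fun i hi => by
    rw [Atom.subst_cut (hA i hi), Atom.subst_cut (hB i hi), hσ.1 i hi]
  intro x hx
  have hx' := hη x
  by_cases h : argList (σ x) = W
  · refine ⟨h, ?_⟩
    generalize σ x = t at hx hx' h
    cases t with
    | var y => simp at hx
    | func f ts =>
      subst h
      simp only [cut, argList, if_true, Term.subst, Term.func.injEq, heq_eq_eq, true_and] at hx'
      intro s hs
      simp only [argList, List.mem_ofFn] at hs
      obtain ⟨i, rfl⟩ := hs
      intro hc
      have := hc.subst η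
      rw [← congrFun hx' i] at this
      exact not_isCompound_collapse _ this
  · have := hx.subst η
    rw [← hx', cut_of_ne h] at this
    exact absurd this (not_isCompound_collapse _)

theorem Conforms.argList_subst {σ : Sub L} {W : List (L.Term ℕ)} {t : L.Term ℕ}
    (h : Conforms σ W t) (hs : Shaped σ W) (hc : IsCompound (t.subst σ)) :
    argList (t.subst σ) = W ∧ ∀ s ∈ W, ¬ IsCompound s := by
  by_cases ht : IsCompound t
  · obtain ⟨h1, h2⟩ := h ht
    have h3 := (TopVar.argList_subst ht σ).trans h2
    refine ⟨h3, fun s hsW => ?_⟩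
    rw [← h2, List.mem_map] at hsW
    obtain ⟨r, hr, rfl⟩ := hsW
    refine not_isCompound_subst (h1 r hr) fun x hx hcx => ?_
    rw [eq_var_of_mem_varFinset (h1 r hr) hx] at hr
    refine argList_ne_of_mem ?_ (hs x hcx).1
    rw [← h2]
    exact List.mem_map_of_mem (f := fun s : L.Term ℕ => s.subst σ) hr
  · rcases eq_var_or_const ht with ⟨x, rfl⟩ | ⟨c, rfl⟩
    · exact hs x hc
    · rw [subst_of_ground (by simp)] at hc
      exact absurd hc ht

end Shape

/-! ### Loosely guarded clauses under substitutions -/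

section Guarded

variable {L : FirstOrder.Language.{u, v}}

/-- A common sufficient condition for the conclusion of an inference to be loosely guarded: the
compound terms of the instance have the argument list `W`, which contains all variables of the
instance, and the instance contains the guards of an instance of the clause `G`. -/
theorem isLG_subst {σ : Sub L} {W : List (L.Term ℕ)} {K G : Clause L} (hs : Shaped σ W)
    (hK : ∀ l ∈ K, ∀ i, Conforms σ W (l.atom.args i))
    (hG : Clause.IsGround G ∨ HasLooseGuard G) (hGK : ∀ l ∈ G, l.IsNeg → l ∈ K)
    (hGσ : ∀ x ∈ Clause.vars G, ¬ IsCompound (σ x))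
    (hKW : ∀ x ∈ Clause.vars K, ∀ z ∈ (σ x).varFinset, ∃ s ∈ W, z ∈ s.varFinset)
    (hWG : ∀ s ∈ W, s.varFinset ⊆ Clause.vars (Clause.subst G σ)) :
    IsLG (Clause.subst K σ) ∧ Clause.width (Clause.subst K σ) ≤ Clause.width G := by
  have harg : ∀ l ∈ Clause.subst K σ, ∀ i, IsCompound (l.atom.args i) →
      argList (l.atom.args i) = W ∧ ∀ s ∈ W, ¬ IsCompound s := by
    intro l₁ hl₁
    obtain ⟨l, hl, rfl⟩ := Clause.mem_subst.1 hl₁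
    rw [Lit.atom_subst]
    exact fun i => (hK l hl i).argList_subst hs
  have hsub : Clause.vars (Clause.subst K σ) ⊆ Clause.vars (Clause.subst G σ) := by
    intro z hz
    obtain ⟨x, hx, hz⟩ := Clause.mem_vars_subst.1 hz
    obtain ⟨s, hs, hz⟩ := hKW x hx z hz
    exact hWG s hs hz
  -- compound terms occur only as arguments of literals
  have hterm : ∀ t, Clause.HasTerm (Clause.subst K σ) t → IsCompound t →
      argList t = W ∧ ∃ l ∈ Clause.subst K σ, ∃ i, t = l.atom.args i := by
    rintro t ⟨l, hl, i, hti⟩ ht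
    rcases isSubterm_cases hti with h | ⟨r, hr, h⟩
    · exact ⟨h ▸ (harg l hl i (h ▸ ht)).1, l, hl, i, h⟩
    · have hc : IsCompound (l.atom.args i) := fun h0 => by rw [h0] at hr; simp at hr
      obtain ⟨h1, h2⟩ := harg l hl i hc
      have hr' := h2 r (h1 ▸ hr)
      exact absurd ht (eq_of_isSubterm_of_not_isCompound h hr' ▸ hr')
  refine ⟨⟨?_, ?_, ?_, ?_⟩, ?_⟩
  · intro l hl i
    by_cases hc : IsCompound (l.atom.args i)
    · obtain ⟨h1, h2⟩ := harg l hl i hc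
      exact .inr ⟨hc, h1 ▸ h2⟩
    · exact .inl hc
  · intro t ht hc
    obtain ⟨h1, l, hl, i, rfl⟩ := hterm t ht hc
    refine Finset.Subset.antisymm (fun z hz => ?_) fun z hz => ?_
    · exact Clause.mem_vars.2 ⟨l, hl, Atom.mem_vars.2 ⟨i, hz⟩⟩
    · obtain ⟨x, hx, hz⟩ := Clause.mem_vars_subst.1 hz
      rw [mem_varFinset_iff_argList hc, h1]
      exact hKW x hx z hz
  · intro s t hs ht hcs hct
    rw [(hterm s hs hcs).1, (hterm t ht hct).1]
  · rcases hG with hG | hG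
    · left
      refine Finset.eq_empty_of_forall_notMem fun z hz => ?_
      obtain ⟨x, hx, -⟩ := Clause.mem_vars_subst.1 (hsub hz)
      rw [hG] at hx
      simp at hx
    · right
      intro z hz z' hz'
      obtain ⟨x, hx, hzx⟩ := Clause.mem_vars_subst.1 (hsub hz)
      obtain ⟨x', hx', hzx'⟩ := Clause.mem_vars_subst.1 (hsub hz')
      obtain ⟨l, hl, hn, hf, h1, h2⟩ := hG x hx x' hx'
      refine ⟨l.subst σ, Clause.mem_subst.2 ⟨l, hGK l hl hn, rfl⟩, (Lit.isNeg_subst _ _).2 hn, ?_,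
        Lit.mem_vars_subst.2 ⟨x, h1, hzx⟩, Lit.mem_vars_subst.2 ⟨x', h2, hzx'⟩⟩
      unfold Lit.IsFlat
      rw [Lit.atom_subst]
      exact fun i => not_isCompound_subst (hf i) fun y hy =>
        hGσ y (Clause.mem_vars.2 ⟨l, hl, Atom.mem_vars.2 ⟨i, hy⟩⟩)
  · unfold Clause.width
    calc (Clause.vars (Clause.subst K σ)).card
        ≤ ((Clause.vars G).biUnion fun x => (σ x).varFinset).card :=
          Finset.card_le_card fun z hz => Finset.mem_biUnion.2 (Clause.mem_vars_subst.1 (hsub hz))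
      _ ≤ (Clause.vars G).card * 1 :=
          Finset.card_biUnion_le_card_mul _ _ _ fun x hx => card_varFinset_le_one (hGσ x hx)
      _ = (Clause.vars G).card := mul_one _

/-- All compound terms of the clause have the argument list `v`, which consists of constants and
of all the variables of the clause. A flat ground clause is framed by the empty list. -/
structure Framed (C : Clause L) (v : List (L.Term ℕ)) : Prop where
  args : ∀ l ∈ C, ∀ i, IsCompound (l.atom.args i) → argList (l.atom.args i) = v
  flat : ∀ s ∈ v, ¬ IsCompound s
  vars : ∀ s ∈ v, s.varFinset ⊆ Clause.vars C
  cover : ∀ x ∈ Clause.vars C, .var x ∈ v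

theorem IsLG.framed {C : Clause L} (h : IsLG C) {l : Lit L} (hl : l ∈ C) {i : Fin l.atom.arity}
    (hc : IsCompound (l.atom.args i)) : Framed C (argList (l.atom.args i)) := by
  obtain ⟨h1, h2, h3, -⟩ := h
  have hflat : ∀ s ∈ argList (l.atom.args i), ¬ IsCompound s := by
    rcases h1 l hl i with h | h
    · exact absurd hc h
    · exact h.2
  have hcov := h2 _ ⟨l, hl, i, .refl⟩ hc
  refine ⟨fun l' hl' j hj => h3 _ _ ⟨l', hl', j, .refl⟩ ⟨l, hl, i, .refl⟩ hj hc, hflat, ?_, ?_⟩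
  · intro s hs x hx
    rw [← hcov]
    exact (mem_varFinset_iff_argList hc).2 ⟨s, hs, hx⟩
  · intro x hx
    rw [← hcov] at hx
    obtain ⟨s, hs, hx⟩ := (mem_varFinset_iff_argList hc).1 hx
    rwa [eq_var_of_mem_varFinset (hflat s hs) hx] at hs

theorem framed_nil {C : Clause L} (h : ∀ l ∈ C, l.IsFlat) (hg : Clause.IsGround C) :
    Framed C [] where
  args l hl i hi := absurd hi (h l hl i)
  flat := by simp
  vars := by simp
  cover x hx := by rw [hg] at hx; simp at hx

theorem Framed.conforms {C : Clause L} {v : List (L.Term ℕ)} (h : Framed C v) (σ : Sub L)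
    {l : Lit L} (hl : l ∈ C) (i : Fin l.atom.arity) :
    Conforms σ (v.map fun s => s.subst σ) (l.atom.args i) := fun hc => by
  rw [h.args l hl i hc]
  exact ⟨h.flat, rfl⟩

theorem Framed.mem_map {C : Clause L} {v : List (L.Term ℕ)} (h : Framed C v) (σ : Sub L)
    {x : ℕ} (hx : x ∈ Clause.vars C) : σ x ∈ v.map fun s => s.subst σ :=
  List.mem_map.2 ⟨_, h.cover x hx, rfl⟩

theorem Framed.not_isCompound {C : Clause L} {v : List (L.Term ℕ)} (h : Framed C v) {σ : Sub L}
    (hs : Shaped σ (v.map fun s => s.subst σ)) {x : ℕ} (hx : x ∈ Clause.vars C) :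
    ¬ IsCompound (σ x) :=
  fun hc => argList_ne_of_mem (h.mem_map σ hx) (hs x hc).1

theorem Framed.vars_map {C : Clause L} {v : List (L.Term ℕ)} (h : Framed C v) (σ : Sub L) :
    ∀ s ∈ v.map fun s => s.subst σ, s.varFinset ⊆ Clause.vars (Clause.subst C σ) := by
  intro s hs z hz
  obtain ⟨r, hr, rfl⟩ := List.mem_map.1 hs
  obtain ⟨y, hy, hz⟩ := mem_varFinset_subst.1 hz
  exact Clause.mem_vars_subst.2 ⟨y, h.vars r hr hy, hz⟩

/-- The general form of the resolvents that occur: the main premise `M` is resolved with the side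
premises `B i ∨ E i` for `i ∈ S`, and the frames of all premises are mapped to the same list `W`. -/
theorem isLG_resolvent {ι : Type*} {A B : ι → Atom L} {S : Set ι} {E : ι → Clause L} {σ : Sub L}
    {W : List (L.Term ℕ)} {w : ι → List (L.Term ℕ)} {K M : Clause L} (hσ : IsMGU A B S σ)
    (hLG : ∀ i ∈ S, IsLG (Lit.pos (B i) ::ₘ E i))
    (hfr : ∀ i ∈ S, Framed (Lit.pos (B i) ::ₘ E i) (w i))
    (hW : ∀ i ∈ S, (w i).map (fun s => s.subst σ) = W)
    (hM : ∀ l ∈ M, ∀ k, Conforms σ W (l.atom.args k)) (hA : ∀ i ∈ S, Lit.neg (A i) ∈ M)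
    (hMv : ∀ x ∈ Clause.vars M, ∃ i ∈ S, x ∈ (A i).vars)
    (hK : ∀ l ∈ K, l ∈ M ∨ ∃ i ∈ S, l ∈ E i) (hEK : ∀ i ∈ S, ∀ l ∈ E i, l ∈ K)
    {i : ι} (hi : i ∈ S) :
    IsLG (Clause.subst K σ) ∧
      Clause.width (Clause.subst K σ) ≤ Clause.width (Lit.pos (B i) ::ₘ E i) := by
  have hside : ∀ j ∈ S, ∀ l ∈ Lit.pos (B j) ::ₘ E j, ∀ k, Conforms σ W (l.atom.args k) :=
    fun j hj l hl k => hW j hj ▸ (hfr j hj).conforms σ hl k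
  have hshape : Shaped σ W := hσ.shaped (fun j hj k => hM _ (hA j hj) k)
    fun j hj k => hside j hj (.pos (B j)) (Multiset.mem_cons_self _ _) k
  have hsideW : ∀ j ∈ S, ∀ x ∈ Clause.vars (Lit.pos (B j) ::ₘ E j), σ x ∈ W :=
    fun j hj x hx => hW j hj ▸ (hfr j hj).mem_map σ hx
  refine isLG_subst hshape ?_ (hLG i hi).2.2.2 ?_ ?_ ?_ ?_
  · intro l hl k
    rcases hK l hl with h | ⟨j, hj, h⟩
    · exact hM l h k
    · exact hside j hj l (Multiset.mem_cons_of_mem h) k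
  · intro l hl hn
    rcases Multiset.mem_cons.1 hl with rfl | hl
    · exact hn.elim
    · exact hEK i hi l hl
  · intro x hx
    exact (hfr i hi).not_isCompound (by rwa [hW i hi]) hx
  · intro x hx z hz
    obtain ⟨l, hl, hxl⟩ := Clause.mem_vars.1 hx
    rcases hK l hl with h | ⟨j, hj, h⟩
    · obtain ⟨j, hj, hxj⟩ := hMv x (Clause.mem_vars.2 ⟨l, h, hxl⟩)
      have hz' := Atom.mem_vars_subst.2 ⟨x, hxj, hz⟩
      rw [hσ.1 j hj] at hz'
      obtain ⟨y, hy, hzy⟩ := Atom.mem_vars_subst.1 hz'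
      exact ⟨σ y, hsideW j hj y (Clause.mem_vars.2 ⟨_, Multiset.mem_cons_self _ _, hy⟩), hzy⟩
    · exact ⟨σ x, hsideW j hj x (Clause.mem_vars.2 ⟨l, Multiset.mem_cons_of_mem h, hxl⟩), hz⟩
  · exact hW i hi ▸ (hfr i hi).vars_map σ

/-! ### Selected literals and maximal literals -/

open Classical in
theorem selected_eq_zero_iff (sel : SelectNC L) (C : Clause L) : sel.selected C = 0 ↔
    Clause.IsGround C ∨ ((∀ l ∈ C, l.IsNeg → l.IsFlat) ∧
      ((∃ l ∈ C, ¬ l.IsNeg ∧ ¬ l.IsFlat) ∨ ∀ l ∈ C, ¬ l.IsNeg)) := by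
  unfold SelectNC.selected
  split_ifs with h1 h2 h3
  · simp [h1]
  · obtain ⟨l, hl, hn, hf⟩ := h2
    simp only [h1, false_or, Multiset.singleton_ne_zero, false_iff, not_and]
    exact fun h => absurd (h l hl hn) hf
  · push Not at h2
    simp only [true_iff]
    exact .inr ⟨h2, .inl h3⟩
  · push Not at h2
    simp only [h1, h3, false_or, Multiset.filter_eq_nil]
    exact ⟨fun h => ⟨h2, h⟩, fun h => h.2⟩

/-- A non-ground loosely guarded clause has a guard, which is selected if the clause is flat. So
without selected literals there is a compound-term literal. -/
theorem IsLG.of_selected_eq_zero {sel : SelectNC L} {C : Clause L} (h : IsLG C)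
    (h0 : sel.selected C = 0) : Clause.IsGround C ∨ ∃ l ∈ C, ¬ l.IsFlat := by
  rcases (selected_eq_zero_iff sel C).1 h0 with hg | ⟨-, ⟨l, hl, -, hf⟩ | hn⟩
  · exact .inl hg
  · exact .inr ⟨l, hl, hf⟩
  · rcases h.2.2.2 with hg | hg
    · exact .inl hg
    · refine .inl (Finset.eq_empty_of_forall_notMem fun x hx => ?_)
      obtain ⟨l, hl, hneg, -⟩ := hg x hx x hx
      exact hn l hl hneg

open Classical in
theorem selected_of_ne_zero {sel : SelectNC L} {C : Clause L} (h0 : sel.selected C ≠ 0) :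
    ¬ Clause.IsGround C ∧
      ((∃ l ∈ C, sel.selected C = {l} ∧ l.IsNeg ∧ ¬ l.IsFlat) ∨
       ((∀ l ∈ C, l.IsFlat) ∧ sel.selected C = C.filter fun l => l.IsNeg)) := by
  unfold SelectNC.selected at h0 ⊢
  split_ifs at h0 ⊢ with h1 h2 h3
  · exact absurd rfl h0
  · obtain ⟨h4, h5, h6⟩ := sel.spec C h1 h2
    exact ⟨h1, .inl ⟨_, h4, rfl, h5, h6⟩⟩
  · exact absurd rfl h0
  · push Not at h2 h3
    refine ⟨h1, .inr ⟨fun l hl => ?_, rfl⟩⟩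
    by_cases hn : l.IsNeg
    · exact h2 l hl hn
    · exact h3 l hl hn

theorem IsLG.exists_framed {sel : SelectNC L} {C : Clause L} (h : IsLG C)
    (h0 : sel.selected C = 0) : ∃ w, Framed C w ∧
      ((w = [] ∧ ∀ l ∈ C, l.IsFlat) ∨
        ∃ l ∈ C, ∃ i, IsCompound (l.atom.args i) ∧ argList (l.atom.args i) = w) := by
  by_cases hf : ∀ l ∈ C, l.IsFlat
  · rcases h.of_selected_eq_zero h0 with hg | ⟨l, hl, hl'⟩
    · exact ⟨[], framed_nil hf hg, .inl ⟨rfl, hf⟩⟩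
    · exact absurd (hf l hl) hl'
  · simp only [Lit.IsFlat, not_forall, not_not] at hf
    obtain ⟨l, hl, i, hi⟩ := hf
    exact ⟨_, h.framed hl hi, .inr ⟨l, hl, i, hi, rfl⟩⟩

theorem isLG_factor {P : Precedence L} {sel : SelectNC L} {e : Eligibility} {C R : Clause L}
    (h : IsLG C) (hR : Factor P sel e C R) : IsLG R ∧ Clause.width R ≤ Clause.width C := by
  obtain ⟨D, A₁, A₂, σ, h0, -, hσ⟩ := hR
  obtain ⟨w, hw, -⟩ := h.exists_framed h0
  have hmem : ∀ l ∈ Lit.pos A₁ ::ₘ D, l ∈ Lit.pos A₁ ::ₘ Lit.pos A₂ ::ₘ D := by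
    simp only [Multiset.mem_cons]; tauto
  have hs : Shaped σ (w.map fun s => s.subst σ) := hσ.shaped
    (fun _ _ k => hw.conforms σ (l := .pos A₁) (by simp) k)
    fun _ _ k => hw.conforms σ (l := .pos A₂) (by simp) k
  refine isLG_subst hs (fun l hl i => hw.conforms σ (hmem l hl) i) h.2.2.2 ?_
    (fun x hx => hw.not_isCompound hs hx) (fun x hx z hz => ⟨σ x, hw.mem_map σ ?_, hz⟩)
    (hw.vars_map σ)
  · intro l hl hn
    rcases Multiset.mem_cons.1 hl with rfl | hl
    · exact hn.elim
    rcases Multiset.mem_cons.1 hl with rfl | hl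
    · exact hn.elim
    · exact Multiset.mem_cons_of_mem hl
  · obtain ⟨l, hl, hx⟩ := Clause.mem_vars.1 hx
    exact Clause.mem_vars.2 ⟨l, hmem l hl, hx⟩

end Guarded

/-! ### Resolvents of loosely guarded clauses -/

section Resolvents

variable {L : FirstOrder.Language.{u, v}}

theorem Atom.args_of_subst_eq {A B : Atom L} {σ : Sub L} (h : A.subst σ = B.subst σ)
    (k : Fin A.arity) : ∃ j : Fin B.arity, ∀ τ : Sub L, A.subst τ = B.subst τ →
      (A.args k).subst τ = (B.args j).subst τ := by
  obtain ⟨n, p, as⟩ := A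
  obtain ⟨m, q, bs⟩ := B
  simp only [Atom.subst, Atom.mk.injEq] at h
  obtain ⟨rfl, h1, -⟩ := h
  obtain rfl := eq_of_heq h1
  refine ⟨k, fun τ hτ => ?_⟩
  simp only [Atom.subst, Atom.mk.injEq, heq_eq_eq, true_and] at hτ
  exact congrFun hτ k

theorem Atom.mem_vars_of_args_eq {A : Atom L} {i : Fin A.arity} {x : ℕ}
    (h : A.args i = .var x) : x ∈ A.vars :=
  Atom.mem_vars.2 ⟨i, by simp [h]⟩

theorem Framed.args_pos {C : Clause L} {w : List (L.Term ℕ)} (h : Framed C w) {B : Atom L}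
    (hB : Lit.pos B ∈ C) (i : Fin B.arity) (hi : IsCompound (B.args i)) :
    argList (B.args i) = w :=
  h.args _ hB i hi

section Maximal

variable [Nonempty L.Constants]

/-- A literal that is not dominated by compound-term literals in some instance has a compound
argument if the clause has one at all. -/
theorem exists_compound_arg {P : Precedence L} {C : Clause L} (hC : IsLG C) {l₀ : Lit L}
    (hl₀ : l₀ ∈ C) {τ : Sub L} (hmax : ∀ l ∈ C, ¬ P.LitGT (l.subst τ) (l₀.subst τ))
    {l : Lit L} (hl : l ∈ C) (hlc : ¬ l.IsFlat) : ∃ k, IsCompound (l₀.atom.args k) := by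
  by_contra hcon
  push Not at hcon
  simp only [Lit.IsFlat, not_forall, not_not] at hlc
  obtain ⟨i, hi⟩ := hlc
  refine hmax l hl (.inl ?_)
  rw [Lit.atom_subst, Lit.atom_subst]
  refine P.lpo_of_flat hcon hi ?_ τ
  rw [hC.2.1 _ ⟨l, hl, i, .refl⟩ hi]
  exact fun x hx => Clause.mem_vars.2 ⟨l₀, hl₀, hx⟩

theorem IsSide.exists_framed {P : Precedence L} {sel : SelectNC L} {ρ : Sub L} {B : Atom L}
    {E : Clause L} (h : IsSide P sel ρ B E) (hLG : IsLG (Lit.pos B ::ₘ E)) :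
    ∃ w, Framed (Lit.pos B ::ₘ E) w ∧ (w = [] ∨ ∃ k, IsCompound (B.args k) ∧
      argList (B.args k) = w) := by
  obtain ⟨w, hw, ⟨rfl, -⟩ | ⟨l, hl, i, hi, -⟩⟩ := hLG.exists_framed h.1
  · exact ⟨_, hw, .inl rfl⟩
  obtain ⟨τ, -, hmax⟩ := h.2
  obtain ⟨k, hk⟩ := exists_compound_arg (P := P) hLG (Multiset.mem_cons_self (Lit.pos B) E)
    (τ := fun x => (ρ x).subst τ) (by
      intro l hl
      rw [← Lit.subst_subst, ← Lit.subst_subst]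
      rcases Multiset.mem_cons.1 hl with rfl | hl
      · exact P.litGT_irrefl _
      · exact P.litGT_asymm (hmax _ (Clause.mem_subst.2 ⟨l, hl, rfl⟩))) hl fun hf => hf i hi
  exact ⟨w, hw, .inr ⟨k, hk, hw.args _ (Multiset.mem_cons_self _ _) k hk⟩⟩

/-- The literal of the main premise of a binary resolution inference is a compound-term literal,
or it contains all variables and the premise is flat. -/
theorem main_premise_cases {P : Precedence L} {sel : SelectNC L} {ρ : Sub L} {A : Atom L}
    {D : Clause L} (hLG : IsLG (Lit.neg A ::ₘ D))
    (h : sel.selected (Lit.neg A ::ₘ D) = {Lit.neg A} ∨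
        (sel.selected (Lit.neg A ::ₘ D) = 0 ∧
          P.IsMax (Lit.neg (A.subst ρ)) (Clause.subst D ρ))) :
    (∃ k, IsCompound (A.args k)) ∨
      ((∀ l ∈ Lit.neg A ::ₘ D, l.IsFlat) ∧ Clause.vars (Lit.neg A ::ₘ D) ⊆ A.vars) := by
  classical
  rcases h with h | ⟨h0, τ, -, hmax⟩
  · have hne : sel.selected (Lit.neg A ::ₘ D) ≠ 0 := by simp [h]
    obtain ⟨hg, ⟨l, -, hl, -, hf⟩ | ⟨hf, hs⟩⟩ := selected_of_ne_zero hne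
    · rw [h, Multiset.singleton_inj] at hl
      subst hl
      simp only [Lit.IsFlat, not_forall, not_not] at hf
      exact .inl hf
    · refine .inr ⟨hf, fun x hx => ?_⟩
      obtain ⟨l, hl, hn, -, hxl, -⟩ := (hLG.2.2.2.resolve_left hg) x hx x hx
      have : l ∈ sel.selected (Lit.neg A ::ₘ D) := by
        rw [hs]; exact Multiset.mem_filter.2 ⟨hl, hn⟩
      rw [h, Multiset.mem_singleton] at this
      rwa [this] at hxl
  · by_cases hf : ∀ l ∈ Lit.neg A ::ₘ D, l.IsFlat
    · refine .inr ⟨hf, ?_⟩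
      rcases hLG.of_selected_eq_zero h0 with hg | ⟨l, hl, hl'⟩
      · rw [hg]; exact Finset.empty_subset _
      · exact absurd (hf l hl) hl'
    · push Not at hf
      obtain ⟨l, hl, hlf⟩ := hf
      refine .inl (exists_compound_arg (P := P) hLG (Multiset.mem_cons_self (Lit.neg A) D)
        (τ := fun x => (ρ x).subst τ) ?_ hl hlf)
      intro l hl
      rw [← Lit.subst_subst, ← Lit.subst_subst]
      rcases Multiset.mem_cons.1 hl with rfl | hl
      · exact P.litGT_irrefl _
      · rcases hmax _ (Clause.mem_subst.2 ⟨l, hl, rfl⟩) with h | h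
        · rw [← h]; exact P.litGT_irrefl _
        · exact P.litGT_asymm h

end Maximal

/-- If a compound-term atom of a framed clause is unified with the maximal atom of a framed side
premise, the two frames are unified. Otherwise there would be a variable on either side that is
mapped to a term properly containing the image of the other. -/
theorem Framed.map_eq_map {M G : Clause L} {u w : List (L.Term ℕ)} (hM : Framed M u)
    (hG : Framed G w) {A B : Atom L} (hA : A.vars ⊆ Clause.vars M) (hB : Lit.pos B ∈ G)
    {k : Fin A.arity} (hk : IsCompound (A.args k)) (hku : argList (A.args k) = u)
    (hw : w = [] ∨ ∃ k, IsCompound (B.args k) ∧ argList (B.args k) = w) {σ : Sub L}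
    (h : A.subst σ = B.subst σ) (hAM : ∀ i, IsCompound (A.args i) → argList (A.args i) = u) :
    w.map (fun s => s.subst σ) = u.map fun s => s.subst σ := by
  have hBv : ∀ {y j}, B.args j = .var y → .var y ∈ w := fun {y j} hy =>
    hG.cover y (Clause.mem_vars.2 ⟨_, hB, Atom.mem_vars_of_args_eq hy⟩)
  have hAv : ∀ {x i}, A.args i = .var x → .var x ∈ u := fun {x i} hx =>
    hM.cover x (hA (Atom.mem_vars_of_args_eq hx))
  obtain ⟨j, hj⟩ := Atom.args_of_subst_eq h k
  replace hj := hj σ h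
  by_cases hcj : IsCompound (B.args j)
  · rw [← hku, ← hG.args_pos hB j hcj, ← argList_subst hk, ← argList_subst hcj, hj]
  rcases eq_var_or_const hcj with ⟨y, hy⟩ | ⟨c, hc⟩
  · rcases hw with rfl | ⟨k', hk', hkw⟩
    · simpa using hBv hy
    obtain ⟨i, hi⟩ := Atom.args_of_subst_eq h.symm k'
    replace hi := hi σ h.symm
    by_cases hci : IsCompound (A.args i)
    · rw [← hkw, ← hAM i hci, ← argList_subst hk', ← argList_subst hci, hi]
    exfalso
    rcases eq_var_or_const hci with ⟨x, hx⟩ | ⟨c, hc⟩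
    · have h1 : depth (σ x) < depth ((A.args k).subst σ) := by
        refine depth_lt_of_mem_argList ?_
        rw [argList_subst hk, hku]
        exact List.mem_map.2 ⟨_, hAv hx, rfl⟩
      have h2 : depth (σ y) < depth ((B.args k').subst σ) := by
        refine depth_lt_of_mem_argList ?_
        rw [argList_subst hk', hkw]
        exact List.mem_map.2 ⟨_, hBv hy, rfl⟩
      rw [hj, hy] at h1
      rw [hi, hx] at h2
      exact lt_asymm h1 h2
    · have := hk'.subst σ
      rw [hi, hc, subst_of_ground (by simp), isCompound_func] at this
      exact this rfl
  · have := hk.subst σ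
    rw [hj, hc, subst_of_ground (by simp), isCompound_func] at this
    exact absurd rfl this

/-- Top variables of a flat main premise are matched with compound terms of the side premises, or
all side premises are flat and ground. In both cases the frames of the side premises that are
resolved upon are unified. -/
theorem exists_common_frame {n : ℕ} {A B : Fin n → Atom L} {G : Fin n → Clause L}
    {w : Fin n → List (L.Term ℕ)} {S : Finset (Fin n)} {σ' σ : Sub L} {x₀ : ℕ}
    (hA : ∀ i k, ¬ IsCompound ((A i).args k)) (hB : ∀ i, Lit.pos (B i) ∈ G i)
    (hG : ∀ i, Framed (G i) (w i))
    (hw : ∀ i, w i = [] ∨ ∃ k, IsCompound ((B i).args k) ∧ argList ((B i).args k) = w i)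
    (hσ' : ∀ i, (A i).subst σ' = (B i).subst σ') (hσ : ∀ i ∈ S, (A i).subst σ = (B i).subst σ)
    (hS : ∀ i, i ∈ S ↔ ∃ x ∈ (A i).vars, IsTopVariable A σ' x) (hx₀ : IsTopVariable A σ' x₀)
    (hguard : ∀ i, ∀ x ∈ (A i).vars, ∀ j, ∀ y ∈ (A j).vars,
      ∃ k, x ∈ (A k).vars ∧ y ∈ (A k).vars) :
    ∃ W, ∀ i ∈ S, (w i).map (fun s => s.subst σ) = W := by
  -- a side premise that is not flat makes some variable deep
  have hdeep : ∀ i, w i ≠ [] → ∃ z ∈ (A i).vars, ∃ j, IsCompound ((B i).args j) ∧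
      argList ((B i).args j) = w i ∧ σ' z = ((B i).args j).subst σ' := by
    intro i hi
    obtain ⟨j, hj, hjw⟩ := (hw i).resolve_left hi
    obtain ⟨k, hk⟩ := Atom.args_of_subst_eq (hσ' i).symm j
    replace hk := hk σ' (hσ' i).symm
    rcases eq_var_or_const (hA i k) with ⟨z, hz⟩ | ⟨c, hc⟩
    · exact ⟨z, Atom.mem_vars.2 ⟨k, by simp [hz]⟩, j, hj, hjw, by rw [hk, hz]; rfl⟩
    · have := hj.subst σ'
      rw [hk, hc, subst_of_ground (by simp), isCompound_func] at this
      exact absurd rfl this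
  by_cases h0 : depth (σ' x₀) = 0
  · refine ⟨[], fun i _ => ?_⟩
    by_contra hne
    obtain ⟨z, hz, j, hj, -, h⟩ := hdeep i fun h => hne (by rw [h]; rfl)
    have h1 := hx₀.2 i z hz
    rw [h, h0] at h1
    exact (depth_pos (hj.subst σ')).not_ge h1
  -- a top variable of `A i` is matched with a compound argument of `B i`
  have htop : ∀ i ∈ S, ∀ x ∈ (A i).vars, IsTopVariable A σ' x →
      argList (σ x) = (w i).map fun s => s.subst σ := by
    intro i hi x hx hxt
    obtain ⟨i₀, hi₀⟩ := hx₀.1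
    have hpos : depth (σ' x) ≠ 0 := fun h => h0 (Nat.le_zero.1 (h ▸ hxt.2 i₀ x₀ hi₀))
    obtain ⟨k, hk⟩ := Atom.mem_vars.1 hx
    have hkx := eq_var_of_mem_varFinset (hA i k) hk
    obtain ⟨j, hj⟩ := Atom.args_of_subst_eq (hσ' i) k
    have hj' := hj σ' (hσ' i)
    replace hj := hj σ (hσ i hi)
    rw [hkx] at hj hj'
    change σ x = _ at hj
    change σ' x = _ at hj'
    by_cases hc : IsCompound ((B i).args j)
    · rw [hj, argList_subst hc, (hG i).args_pos (hB i) j hc]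
    exfalso
    rcases eq_var_or_const hc with ⟨y, hy⟩ | ⟨c, hcc⟩
    · have hyw : .var y ∈ w i :=
        (hG i).cover y (Clause.mem_vars.2 ⟨_, hB i, Atom.mem_vars_of_args_eq hy⟩)
      obtain ⟨z, hz, j', hcj', hj'w, hzj'⟩ := hdeep i fun h => by rw [h] at hyw; simp at hyw
      have hlt : depth (σ' y) < depth (σ' z) := by
        rw [hzj']
        refine depth_lt_of_mem_argList ?_
        rw [argList_subst hcj', hj'w]
        exact List.mem_map.2 ⟨_, hyw, rfl⟩
      have hle := hxt.2 i z hz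
      rw [hj', hy] at hle
      exact hlt.not_ge hle
    · rw [hj', hcc, subst_of_ground (by simp)] at hpos
      exact hpos (depth_eq_zero (by simp [isCompound_func]))
  refine ⟨argList (σ x₀), fun i hi => ?_⟩
  obtain ⟨x, hx, hxt⟩ := (hS i).1 hi
  obtain ⟨i₀, hi₀⟩ := hx₀.1
  obtain ⟨k, hk, hk'⟩ := hguard i x hx i₀ x₀ hi₀
  have hkS : k ∈ S := (hS k).2 ⟨x, hk, hxt⟩
  rw [← htop i hi x hx hxt, htop k hkS x hk hxt, htop k hkS x₀ hk' hx₀]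

variable [Nonempty L.Constants]

theorem isLG_tres_binary {P : Precedence L} {sel : SelectNC L} {ρ : Sub L} {A B : Atom L}
    {E D : Clause L} {σ : Sub L} (hside : IsLG (Lit.pos B ::ₘ E)) (hmain : IsLG (Lit.neg A ::ₘ D))
    (hσ : IsMGU (fun _ : Unit => A) (fun _ => B) Set.univ σ) (hB : IsSide P sel ρ B E)
    (hA : (∃ k, IsCompound (A.args k)) ∨
      ((∀ l ∈ Lit.neg A ::ₘ D, l.IsFlat) ∧ Clause.vars (Lit.neg A ::ₘ D) ⊆ A.vars)) :
    IsLG (Clause.subst (E + D) σ) ∧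
      Clause.width (Clause.subst (E + D) σ) ≤ Clause.width (Lit.pos B ::ₘ E) := by
  obtain ⟨w, hw, hw'⟩ := hB.exists_framed hside
  have hAB : A.subst σ = B.subst σ := hσ.1 () trivial
  have key : (∀ l ∈ Lit.neg A ::ₘ D, ∀ k, Conforms σ (w.map fun s => s.subst σ) (l.atom.args k)) ∧
      Clause.vars (Lit.neg A ::ₘ D) ⊆ A.vars := by
    rcases hA with ⟨k, hk⟩ | ⟨hf, hv⟩
    · have hu := hmain.framed (Multiset.mem_cons_self (Lit.neg A) D) hk
      rw [hu.map_eq_map hw (fun x hx => Clause.mem_vars.2 ⟨_, Multiset.mem_cons_self _ _, hx⟩)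
        (Multiset.mem_cons_self _ _) hk rfl hw' hAB (hu.args _ (Multiset.mem_cons_self _ _))]
      refine ⟨fun l hl k => hu.conforms σ hl k, ?_⟩
      rw [← hmain.2.1 _ ⟨_, Multiset.mem_cons_self _ _, k, .refl⟩ hk]
      exact fun x hx => Atom.mem_vars.2 ⟨k, hx⟩
    · exact ⟨fun l hl k hk => absurd hk (hf l hl k), hv⟩
  refine isLG_resolvent (w := fun _ => w) (M := Lit.neg A ::ₘ D) (E := fun _ => E) hσ
    (fun _ _ => hside) (fun _ _ => hw) (fun _ _ => rfl) key.1
    (fun _ _ => Multiset.mem_cons_self _ _)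
    (fun x hx => ⟨(), trivial, key.2 hx⟩) (fun l hl => ?_)
    (fun _ _ l hl => Multiset.mem_add.2 (.inl hl)) (i := ()) trivial
  rcases Multiset.mem_add.1 hl with h | h
  · exact .inr ⟨(), trivial, h⟩
  · exact .inl (Multiset.mem_cons_of_mem h)

theorem isLG_tres {P : Precedence L} {sel : SelectNC L} {e : Eligibility} {n : ℕ}
    {sides : Fin n → Clause L} {S : Finset (Fin n)} {main R : Clause L}
    (hsides : ∀ i, IsLG (sides i)) (hmain : IsLG main) (hR : TRes P sel e sides S main R) :
    IsLG R ∧ ∃ i ∈ S, Clause.width R ≤ Clause.width (sides i) := by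
  classical
  cases hR with
  | binary A B E D σ hdisj hσ hB hA =>
    have := isLG_tres_binary (hsides 0) hmain hσ hB (main_premise_cases hmain hA)
    exact ⟨this.1, 0, Finset.mem_univ _, this.2⟩
  | topVariable A B E D σ' σ S _ _ hsel hσ' hB' hS hne hσ hB =>
    set M := Finset.univ.val.map (fun i => Lit.neg (A i)) + D with hMdef
    have hAM : ∀ i, Lit.neg (A i) ∈ M := fun i =>
      Multiset.mem_add.2 (.inl (Multiset.mem_map.2 ⟨i, Finset.mem_univ_val i, rfl⟩))
    have hAv : ∀ i, (A i).vars ⊆ Clause.vars M := fun i x hx => Clause.mem_vars.2 ⟨_, hAM i, hx⟩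
    choose w hw hw' using fun i => (hB i).exists_framed (hsides i)
    obtain ⟨i₀, hi₀⟩ := hne
    obtain ⟨x₀, hx₀, hx₀t⟩ := (hS i₀).1 hi₀
    have hne : sel.selected M ≠ 0 := fun h => by
      have : Lit.neg (A i₀) ∈ sel.selected M := by
        rw [hsel]; exact Multiset.mem_map.2 ⟨i₀, Finset.mem_univ_val _, rfl⟩
      rw [h] at this
      simp at this
    have key : ∃ W, (∀ i ∈ S, (w i).map (fun s => s.subst σ) = W) ∧
        (∀ l ∈ M, ∀ k, Conforms σ W (l.atom.args k)) ∧
        ∀ x ∈ Clause.vars M, ∃ i ∈ S, x ∈ (A i).vars := by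
      obtain ⟨hg, ⟨l, hl, hsl, -, hlf⟩ | ⟨hf, hs⟩⟩ := selected_of_ne_zero hne
      · -- a single compound-term literal is selected
        have hcard := congrArg Multiset.card (hsel.symm.trans hsl)
        simp only [Multiset.card_map, Finset.card_val, Finset.card_univ, Fintype.card_fin,
          Multiset.card_singleton] at hcard
        subst hcard
        obtain rfl : l = Lit.neg (A 0) := by
          have : l ∈ sel.selected M := by rw [hsl]; simp
          rw [hsel] at this
          obtain ⟨i, -, rfl⟩ := Multiset.mem_map.1 this
          rw [Subsingleton.elim i 0]
        simp only [Lit.IsFlat, not_forall, not_not] at hlf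
        obtain ⟨k, hk⟩ := hlf
        have hu := hmain.framed hl hk
        have hS0 : ∀ i, i ∈ S := fun i => Subsingleton.elim i₀ i ▸ hi₀
        refine ⟨_, fun i _ => ?_, fun l hl k => hu.conforms σ hl k, fun x hx => ⟨0, hS0 0, ?_⟩⟩
        · rw [Subsingleton.elim i 0]
          exact hu.map_eq_map (hw 0) (hAv 0) (Multiset.mem_cons_self _ _) hk rfl (hw' 0)
            (hσ.1 0 (hS0 0)) (hu.args _ hl)
        · rw [← hmain.2.1 _ ⟨_, hl, k, .refl⟩ hk] at hx
          exact Atom.mem_vars.2 ⟨k, hx⟩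
      · -- all negative literals of a flat clause are selected
        have hguard : ∀ x ∈ Clause.vars M, ∀ y ∈ Clause.vars M,
            ∃ i, x ∈ (A i).vars ∧ y ∈ (A i).vars := by
          intro x hx y hy
          obtain ⟨l, hl, hn, -, hxl, hyl⟩ := (hmain.2.2.2.resolve_left hg) x hx y hy
          have : l ∈ sel.selected M := by
            rw [hs]; exact Multiset.mem_filter.2 ⟨hl, hn⟩
          rw [hsel] at this
          obtain ⟨i, -, rfl⟩ := Multiset.mem_map.1 this
          exact ⟨i, hxl, hyl⟩
        obtain ⟨W, hW⟩ := exists_common_frame (fun i k => hf _ (hAM i) k)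
          (fun i => Multiset.mem_cons_self _ _) hw hw' (fun i => hσ'.1 i trivial)
          (fun i hi => hσ.1 i hi) hS hx₀t
          (fun i x hx j y hy => hguard x (hAv i hx) y (hAv j hy))
        refine ⟨W, hW, fun l hl k hk => absurd hk (hf l hl k), fun x hx => ?_⟩
        obtain ⟨i, h1, h2⟩ := hguard x hx x₀ (hAv i₀ hx₀)
        exact ⟨i, (hS i).2 ⟨x₀, h2, hx₀t⟩, h1⟩
    obtain ⟨W, hW, hM, hMv⟩ := key
    have := isLG_resolvent (w := w) (M := M) (E := E) (S := (S : Set (Fin n)))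
      (K := ∑ i ∈ S, E i + (Sᶜ).val.map (fun i => Lit.neg (A i)) + D) hσ
      (fun i _ => hsides i) (fun i _ => hw i) hW hM (fun i _ => hAM i) hMv ?_ ?_ hi₀
    · exact ⟨this.1, i₀, hi₀, this.2⟩
    · intro l hl
      rcases Multiset.mem_add.1 hl with h | h
      · rcases Multiset.mem_add.1 h with h | h
        · exact .inr (by simpa using Multiset.mem_sum.1 h)
        · obtain ⟨i, -, rfl⟩ := Multiset.mem_map.1 h
          exact .inl (hAM i)
      · exact .inl (Multiset.mem_add.2 (.inr h))
    · intro i hi l hl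
      exact Multiset.mem_add.2 (.inl (Multiset.mem_add.2 (.inl (Multiset.mem_sum.2 ⟨i, hi, hl⟩))))

end Resolvents

/-! ### Symbols -/

section Symbols

/-- The function symbols that occur in a term. -/
def symsOf {L' : FirstOrder.Language.{u, v}} (t : L'.Term ℕ) : Set (Σ n, L'.Functions n) :=
  {s | ∃ ts, IsSubterm (.func s.2 ts) t}

theorem mem_symsOf_func {L' : FirstOrder.Language.{u, v}} {n : ℕ} {f : L'.Functions n}
    {ts : Fin n → L'.Term ℕ} {s : Σ n, L'.Functions n} :
    s ∈ symsOf (.func f ts) ↔ s = ⟨n, f⟩ ∨ ∃ i, s ∈ symsOf (ts i) := by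
  constructor
  · rintro ⟨ss, h⟩
    rcases isSubterm_cases h with h | ⟨r, hr, h⟩
    · obtain ⟨m, g⟩ := s
      obtain ⟨rfl, h1, -⟩ := Term.func.inj h
      exact .inl (Sigma.ext rfl h1)
    · simp only [argList, List.mem_ofFn] at hr
      obtain ⟨i, rfl⟩ := hr
      exact .inr ⟨i, ss, h⟩
  · rintro (rfl | ⟨i, ss, h⟩)
    · exact ⟨ts, .refl⟩
    · exact ⟨ss, .arg f ts i h⟩

theorem symsOf_var {L' : FirstOrder.Language.{u, v}} (x : ℕ) :
    symsOf (.var x : L'.Term ℕ) = ∅ := by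
  refine Set.eq_empty_of_forall_notMem ?_
  rintro s ⟨ts, h⟩
  cases h

theorem mem_symsOf_subst {L' : FirstOrder.Language.{u, v}} {t : L'.Term ℕ} {σ : ℕ → L'.Term ℕ}
    {s : Σ n, L'.Functions n} :
    s ∈ symsOf (t.subst σ) ↔ s ∈ symsOf t ∨ ∃ x ∈ t.varFinset, s ∈ symsOf (σ x) := by
  induction t with
  | var x => simp [Term.subst, symsOf_var]
  | func f ts ih =>
    simp only [Term.subst, mem_symsOf_func, ih, Term.varFinset, Finset.mem_biUnion,
      Finset.mem_univ, true_and]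
    constructor
    · rintro (h | ⟨i, h | ⟨x, hx, h⟩⟩)
      exacts [.inl (.inl h), .inl (.inr ⟨i, h⟩), .inr ⟨x, ⟨i, hx⟩, h⟩]
    · rintro ((h | ⟨i, h⟩) | ⟨x, ⟨i, hx⟩, h⟩)
      exacts [.inl h, .inr ⟨i, .inl h⟩, .inr ⟨i, .inr ⟨x, hx, h⟩⟩]

theorem finite_symsOf {L' : FirstOrder.Language.{u, v}} (t : L'.Term ℕ) : (symsOf t).Finite := by
  induction t with
  | var x => simp [symsOf_var]
  | func f ts ih =>
    refine ((Set.finite_iUnion ih).insert ⟨_, f⟩).subset fun s hs => ?_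
    rcases mem_symsOf_func.1 hs with h | ⟨i, h⟩
    · exact .inl h
    · exact .inr (Set.mem_iUnion.2 ⟨i, h⟩)

variable {L : FirstOrder.Language.{u, v}}

theorem Clause.mem_syms {C : Clause L} {s : Sym L} :
    s ∈ Clause.syms C ↔ ∃ l ∈ C, s ∈ symsOf l.atom.expr := Iff.rfl

theorem Clause.finite_syms (C : Clause L) : (Clause.syms C).Finite := by
  have : Clause.syms C = ⋃ l ∈ {l | l ∈ C}, symsOf l.atom.expr := by
    ext s; simp [Clause.mem_syms]
  rw [this]
  exact (Multiset.finite_toSet C).biUnion fun l _ => finite_symsOf _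

theorem symsOf_expr_args {A : Atom L} (i : Fin A.arity) :
    symsOf (termExpr (A.args i)) ⊆ symsOf A.expr :=
  fun _ h => mem_symsOf_func.2 (.inr ⟨i, h⟩)

open Classical in
/-- Subterms with a head symbol outside the set `T` are replaced by a variable. -/
def prune (T : Set (Sym L)) : L.Term ℕ → L.Term ℕ
  | .var x => .var x
  | .func f ts => if Sym.ofFun f ∈ T then .func f fun i => prune T (ts i) else .var 0

theorem symsOf_prune (T : Set (Sym L)) (t : L.Term ℕ) : symsOf (termExpr (prune T t)) ⊆ T := by
  induction t with
  | var x => simp [prune, termExpr, symsOf_var]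
  | func f ts ih =>
    unfold prune
    split_ifs with h
    · intro s hs
      rcases mem_symsOf_func.1 hs with rfl | ⟨i, hi⟩
      · exact h
      · exact ih i hi
    · simp [termExpr, symsOf_var]

theorem subst_prune {T : Set (Sym L)} {t : L.Term ℕ} (h : symsOf (termExpr t) ⊆ T) (σ : Sub L) :
    t.subst (fun x => prune T (σ x)) = prune T (t.subst σ) := by
  induction t with
  | var x => rfl
  | func f ts ih =>
    have hf : Sym.ofFun f ∈ T := h (mem_symsOf_func.2 (.inl rfl))
    simp only [Term.subst, prune, hf, if_true, Term.func.injEq, heq_eq_eq, true_and]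
    funext i
    exact ih i fun s hs => h (mem_symsOf_func.2 (.inr ⟨i, hs⟩))

/-- A most general unifier introduces no new symbols: pruning the foreign symbols yields another
unifier. -/
theorem IsMGU.symsOf_subset {ι : Type*} {A B : ι → Atom L} {S : Set ι} {σ : Sub L}
    (hσ : IsMGU A B S σ) {T : Set (Sym L)} (hA : ∀ i ∈ S, symsOf (A i).expr ⊆ T)
    (hB : ∀ i ∈ S, symsOf (B i).expr ⊆ T) (x : ℕ) : symsOf (termExpr (σ x)) ⊆ T := by
  have hprune : ∀ C : Atom L, symsOf C.expr ⊆ T →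
      C.subst (fun x => prune T (σ x)) = (C.subst σ).mapArgs (prune T) := by
    intro C hC
    simp only [Atom.subst, Atom.mapArgs, subst_prune ((symsOf_expr_args _).trans hC)]
  obtain ⟨η, hη⟩ := hσ.2 (fun x => prune T (σ x)) fun i hi => by
    rw [hprune _ (hA i hi), hprune _ (hB i hi), hσ.1 i hi]
  intro s hs
  refine symsOf_prune T (σ x) ?_
  rw [hη x, termExpr_subst]
  exact mem_symsOf_subst.2 (.inl hs)

theorem Clause.syms_subst_subset {C : Clause L} {σ : Sub L} {T : Set (Sym L)}
    (hC : Clause.syms C ⊆ T) (hσ : ∀ x, symsOf (termExpr (σ x)) ⊆ T) :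
    Clause.syms (Clause.subst C σ) ⊆ T := by
  rintro s ⟨l, hl, hs⟩
  obtain ⟨l, hl, rfl⟩ := Clause.mem_subst.1 hl
  change s ∈ symsOf _ at hs
  rw [Lit.atom_subst, Atom.expr_subst] at hs
  rcases mem_symsOf_subst.1 hs with h | ⟨x, -, h⟩
  · exact hC ⟨l, ‹_›, h⟩
  · exact hσ x h

theorem Clause.syms_subset_iff {C : Clause L} {T : Set (Sym L)} :
    Clause.syms C ⊆ T ↔ ∀ l ∈ C, symsOf l.atom.expr ⊆ T :=
  ⟨fun h _ hl _ hs => h ⟨_, hl, hs⟩, fun h _ ⟨l, hl, hs⟩ => h l hl hs⟩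

theorem Factor.syms_subset {P : Precedence L} {sel : SelectNC L} {e : Eligibility} {C R : Clause L}
    (hR : Factor P sel e C R) {T : Set (Sym L)} (hC : Clause.syms C ⊆ T) : Clause.syms R ⊆ T := by
  obtain ⟨D, A₁, A₂, σ, -, -, hσ⟩ := hR
  rw [Clause.syms_subset_iff] at hC
  refine Clause.syms_subst_subset (Clause.syms_subset_iff.2 fun l hl => hC l ?_)
    (hσ.symsOf_subset (fun _ _ => hC (.pos A₁) (by simp)) fun _ _ => hC (.pos A₂) (by simp))
  simp only [Multiset.mem_cons] at hl ⊢
  tauto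

theorem TRes.syms_subset {P : Precedence L} {sel : SelectNC L} {e : Eligibility} {n : ℕ}
    {sides : Fin n → Clause L} {S : Finset (Fin n)} {main R : Clause L}
    (hR : TRes P sel e sides S main R) {T : Set (Sym L)} (hmain : Clause.syms main ⊆ T)
    (hsides : ∀ i, Clause.syms (sides i) ⊆ T) : Clause.syms R ⊆ T := by
  simp only [Clause.syms_subset_iff] at hmain hsides
  cases hR with
  | binary A B E D σ _ hσ _ _ =>
    refine Clause.syms_subst_subset (Clause.syms_subset_iff.2 fun l hl => ?_)
      (hσ.symsOf_subset (fun _ _ => hmain (.neg A) (by simp))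
        fun _ _ => hsides 0 (.pos B) (by simp))
    rcases Multiset.mem_add.1 hl with h | h
    · exact hsides 0 l (Multiset.mem_cons_of_mem h)
    · exact hmain l (Multiset.mem_cons_of_mem h)
  | topVariable A B E D σ' σ S _ _ _ _ _ _ _ hσ _ =>
    have hA : ∀ i, Lit.neg (A i) ∈ Finset.univ.val.map (fun i => Lit.neg (A i)) + D := fun i =>
      Multiset.mem_add.2 (.inl (Multiset.mem_map.2 ⟨i, Finset.mem_univ_val i, rfl⟩))
    refine Clause.syms_subst_subset (Clause.syms_subset_iff.2 fun l hl => ?_)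
      (hσ.symsOf_subset (fun i _ => hmain _ (hA i))
        fun i _ => hsides i _ (Multiset.mem_cons_self (Lit.pos (B i)) (E i)))
    rcases Multiset.mem_add.1 hl with h | h
    · rcases Multiset.mem_add.1 h with h | h
      · obtain ⟨i, -, h⟩ := Multiset.mem_sum.1 h
        exact hsides i l (Multiset.mem_cons_of_mem h)
      · obtain ⟨i, -, rfl⟩ := Multiset.mem_map.1 h
        exact hmain _ (hA i)
    · exact hmain l (Multiset.mem_add.2 (.inr h))

end Symbols

/-! ### Variants, merging and derivations -/

section Variants

variable {L : FirstOrder.Language.{u, v}}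

theorem IsVariant.refl (C : Clause L) : IsVariant C C :=
  ⟨1, (Clause.subst_var C).symm⟩

theorem IsVariant.symm {C D : Clause L} (h : IsVariant C D) : IsVariant D C := by
  obtain ⟨π, rfl⟩ := h
  refine ⟨π⁻¹, ?_⟩
  rw [Clause.subst_subst]
  conv_lhs => rw [← Clause.subst_var C]
  simp [Term.subst]

theorem IsVariant.trans {C D E : Clause L} (h : IsVariant C D) (h' : IsVariant D E) :
    IsVariant C E := by
  obtain ⟨π, rfl⟩ := h
  obtain ⟨ρ, rfl⟩ := h'
  exact ⟨ρ * π, by rw [Clause.subst_subst]; rfl⟩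

theorem IsVariant.isTautology {C D : Clause L} (h : IsVariant C D) (hC : IsTautology C) :
    IsTautology D := by
  obtain ⟨π, rfl⟩ := h
  obtain ⟨A, h1, h2⟩ := hC
  exact ⟨_, Clause.mem_subst.2 ⟨_, h1, rfl⟩, Clause.mem_subst.2 ⟨_, h2, rfl⟩⟩

theorem IsVariant.syms_subset {C D : Clause L} (h : IsVariant C D) {T : Set (Sym L)}
    (hC : Clause.syms C ⊆ T) : Clause.syms D ⊆ T := by
  obtain ⟨π, rfl⟩ := h
  exact Clause.syms_subst_subset hC fun x => by simp [termExpr, symsOf_var]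

theorem IsVariant.isLG_and_width_le {C D : Clause L} (h : IsVariant C D) (hC : IsLG C) :
    IsLG D ∧ Clause.width D ≤ Clause.width C := by
  obtain ⟨π, rfl⟩ := h
  set σ : Sub L := fun x => .var (π x) with hσ
  have hs : ∀ W, Shaped σ W := fun W x hx => absurd hx (not_isCompound_var _)
  by_cases hf : ∀ l ∈ C, l.IsFlat
  · refine isLG_subst (hs ((Clause.vars C).toList.map σ))
      (fun l hl i hi => absurd hi (hf l hl i)) hC.2.2.2 (fun l hl _ => hl)
      (fun x _ => not_isCompound_var _)
      (fun x hx z hz => ⟨σ x, List.mem_map_of_mem (Finset.mem_toList.2 hx), hz⟩) fun s hs z hz => ?_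
    obtain ⟨x, hx, rfl⟩ := List.mem_map.1 hs
    exact Clause.mem_vars_subst.2 ⟨x, Finset.mem_toList.1 hx, hz⟩
  · simp only [Lit.IsFlat, not_forall, not_not] at hf
    obtain ⟨l, hl, i, hi⟩ := hf
    have hw := hC.framed hl hi
    exact isLG_subst (hs _) (fun l hl i => hw.conforms σ hl i) hC.2.2.2 (fun l hl _ => hl)
      (fun x _ => not_isCompound_var _) (fun x hx z hz => ⟨σ x, hw.mem_map σ hx, hz⟩)
      (hw.vars_map σ)

theorem Clause.vars_merge (C : Clause L) : Clause.vars (Clause.merge C) = Clause.vars C := by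
  ext x; simp only [Clause.mem_vars, Clause.mem_merge]

theorem Clause.width_merge (C : Clause L) : Clause.width (Clause.merge C) = Clause.width C := by
  simp only [Clause.width, Clause.vars_merge]

theorem Clause.syms_merge (C : Clause L) : Clause.syms (Clause.merge C) = Clause.syms C := by
  ext s; simp only [Clause.mem_syms, Clause.mem_merge]

theorem IsLG.merge {C : Clause L} (h : IsLG C) : IsLG (Clause.merge C) := by
  simpa only [IsLG, IsSimple, IsCovering, IsStronglyCompatible, Clause.HasTerm, Clause.IsGround,
    HasLooseGuard, Clause.vars_merge, Clause.mem_merge] using h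

theorem Infers.syms_subset {P : Precedence L} {sel : SelectNC L} {e : Eligibility}
    {N : Set (Clause L)} {R : Clause L} (hR : Infers P sel e N R) {T : Set (Sym L)}
    (hN : ∀ C ∈ N, Clause.syms C ⊆ T) : Clause.syms R ⊆ T := by
  cases hR with
  | factor C C' R hC hv hR => exact hR.syms_subset (hv.syms_subset (hN C hC))
  | tres sides S main R hs hm hR =>
    obtain ⟨D, hD, hv⟩ := hm
    refine hR.syms_subset (hv.syms_subset (hN D hD)) fun i => ?_
    obtain ⟨C, hC, hv⟩ := hs i
    exact hv.syms_subset (hN C hC)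

/-- `M` is a finite set of loosely guarded clauses over the symbols of `N`, each of which is no
wider than some clause of `N`. -/
structure BoundedBy (N M : Set (Clause L)) : Prop where
  finite : M.Finite
  isLG : ∀ C ∈ M, IsLG C
  syms : ∀ C ∈ M, Clause.syms C ⊆ ⋃ D ∈ N, Clause.syms D
  width : ∀ C ∈ M, ∃ D ∈ N, Clause.width C ≤ Clause.width D

theorem BoundedBy.refl {N : Set (Clause L)} (hN : N.Finite) (hLG : ∀ C ∈ N, IsLG C) :
    BoundedBy N N :=
  ⟨hN, hLG, fun _ hC => Set.subset_biUnion_of_mem (u := Clause.syms) hC,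
    fun C hC => ⟨C, hC, le_rfl⟩⟩

variable [Nonempty L.Constants]

theorem Infers.isLG {P : Precedence L} {sel : SelectNC L} {e : Eligibility} {N : Set (Clause L)}
    {R : Clause L} (hR : Infers P sel e N R) (hN : ∀ C ∈ N, IsLG C) :
    IsLG R ∧ ∃ C ∈ N, Clause.width R ≤ Clause.width C := by
  cases hR with
  | factor C C' R hC hv hR =>
    obtain ⟨h1, h2⟩ := hv.isLG_and_width_le (hN C hC)
    obtain ⟨h3, h4⟩ := isLG_factor h1 hR
    exact ⟨h3, C, hC, h4.trans h2⟩
  | tres sides S main R hs hm hR =>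
    obtain ⟨D, hD, hv⟩ := hm
    obtain ⟨h3, i, -, h4⟩ := isLG_tres (fun i => by
      obtain ⟨C, hC, hv⟩ := hs i
      exact (hv.isLG_and_width_le (hN C hC)).1) (hv.isLG_and_width_le (hN D hD)).1 hR
    obtain ⟨C, hC, hv⟩ := hs i
    exact ⟨h3, C, hC, h4.trans (hv.isLG_and_width_le (hN C hC)).2⟩

theorem Step.boundedBy {P : Precedence L} {sel : SelectNC L} {e : Eligibility}
    {N M M' : Set (Clause L)} (h : Step P sel e M M') (hM : BoundedBy N M) : BoundedBy N M' := by
  cases h with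
  | deduce _ R hR _ =>
    obtain ⟨h1, C, hC, h2⟩ := hR.isLG hM.isLG
    refine ⟨hM.finite.insert _, ?_, ?_, ?_⟩ <;> rintro D (rfl | hD)
    · exact h1.merge
    · exact hM.isLG D hD
    · rw [Clause.syms_merge]; exact hR.syms_subset hM.syms
    · exact hM.syms D hD
    · rw [Clause.width_merge]
      obtain ⟨D, hD, h3⟩ := hM.width C hC
      exact ⟨D, hD, h2.trans h3⟩
    · exact hM.width D hD
  | delete _ C _ _ =>
    have hsub := Set.subset_insert C M'
    exact ⟨hM.finite.subset hsub, fun D hD => hM.isLG D (hsub hD),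
      fun D hD => hM.syms D (hsub hD), fun D hD => hM.width D (hsub hD)⟩

theorem Derives.boundedBy {P : Precedence L} {sel : SelectNC L} {e : Eligibility}
    {N M M' : Set (Clause L)} (h : Derives P sel e M M') (hM : BoundedBy N M) :
    BoundedBy N M' := by
  induction h with
  | refl => exact hM
  | tail _ h ih => exact h.boundedBy ih

end Variants

/-! ### Termination -/

section Termination

/-- The expressions of height at most `k` with symbols in `T` and variables below `w`. -/
def boundedTerms {L' : FirstOrder.Language.{u, v}} (T : Set (Σ n, L'.Functions n)) (w : ℕ) :
    ℕ → Set (L'.Term ℕ)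
  | 0 => ∅
  | k + 1 => Term.var '' Set.Iio w ∪
      ⋃ s ∈ T, Term.func s.2 '' {ts | ∀ i, ts i ∈ boundedTerms T w k}

theorem finite_boundedTerms {L' : FirstOrder.Language.{u, v}} {T : Set (Σ n, L'.Functions n)}
    (hT : T.Finite) (w k : ℕ) : (boundedTerms T w k).Finite := by
  induction k with
  | zero => exact Set.finite_empty
  | succ k ih =>
    exact ((Set.finite_Iio w).image _).union
      (hT.biUnion fun s _ => (Set.Finite.pi' fun _ => ih).image _)

theorem mem_boundedTerms {L' : FirstOrder.Language.{u, v}} {T : Set (Σ n, L'.Functions n)}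
    {w k : ℕ} {t : L'.Term ℕ} (hs : symsOf t ⊆ T) (hv : ∀ x ∈ t.varFinset, x < w)
    (hd : depth t ≤ k) : t ∈ boundedTerms T w (k + 1) := by
  induction t generalizing k with
  | var x => exact .inl ⟨x, hv x (by simp), rfl⟩
  | @func n f ts ih =>
    refine .inr (Set.mem_iUnion₂.2
      ⟨⟨n, f⟩, hs (mem_symsOf_func.2 (.inl rfl)), ts, fun i => ?_, rfl⟩)
    have hlt : depth (ts i) < depth (.func f ts : L'.Term ℕ) :=
      depth_lt_of_mem_argList (by simp [argList, List.mem_ofFn])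
    cases k with
    | zero => omega
    | succ k =>
      refine ih i (fun s h => hs (mem_symsOf_func.2 (.inr ⟨i, h⟩))) (fun x hx => hv x ?_) (by omega)
      simp only [Term.varFinset, Finset.mem_biUnion]
      exact ⟨i, Finset.mem_univ i, hx⟩

variable {L : FirstOrder.Language.{u, v}}

theorem depth_termExpr (t : L.Term ℕ) : depth (termExpr t) = depth t := by
  induction t with
  | var x => rfl
  | func f ts ih => simp only [termExpr, depth, ih]

theorem depth_expr_le_two {C : Clause L} (hC : IsSimple C) {l : Lit L} (hl : l ∈ C) :
    depth l.atom.expr ≤ 2 := by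
  simp only [Atom.expr, depth]
  split_ifs
  · omega
  · have : ∀ i, depth (termExpr (l.atom.args i)) ≤ 1 := by
      intro i
      rw [depth_termExpr]
      rcases hC l hl i with h | ⟨-, h⟩
      · rw [depth_eq_zero h]; omega
      · generalize l.atom.args i = t at h
        cases t with
        | var x => simp [depth]
        | func f ts =>
          simp only [depth]
          split_ifs
          · omega
          · have : (Finset.univ.sup fun i => depth (ts i)) ≤ 0 :=
              Finset.sup_le fun i _ => (depth_eq_zero (h _ (by simp [argList, List.mem_ofFn]))).le
            omega
    have : (Finset.univ.sup fun i => depth (termExpr (l.atom.args i))) ≤ 1 :=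
      Finset.sup_le fun i _ => this i
    omega

/-- Representatives of the clauses that can be derived: clauses without repeated literals that are
not tautologies, and whose atoms are expressions of bounded height. -/
def representatives (T : Set (Sym L)) (w : ℕ) : Set (Clause L) :=
  {C | C.Nodup ∧ ¬ IsTautology C ∧ ∀ l ∈ C, l.atom.expr ∈ boundedTerms T w 3}

theorem finite_representatives {T : Set (Sym L)} (hT : T.Finite) (w : ℕ) :
    (representatives T w).Finite := by
  have hA : {A : Atom L | A.expr ∈ boundedTerms T w 3}.Finite :=
    (finite_boundedTerms hT w 3).preimage Atom.expr_injective.injOn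
  have hl : {l : Lit L | l.atom.expr ∈ boundedTerms T w 3}.Finite := by
    refine ((hA.image Lit.pos).union (hA.image Lit.neg)).subset ?_
    rintro (A | A) h
    · exact .inl ⟨A, h, rfl⟩
    · exact .inr ⟨A, h, rfl⟩
  refine ((Finset.finite_toSet hl.toFinset.powerset).image Finset.val).subset ?_
  rintro C ⟨h1, -, h3⟩
  refine ⟨⟨C, h1⟩, ?_, rfl⟩
  rw [Finset.mem_coe, Finset.mem_powerset]
  exact fun l hl' => hl.mem_toFinset.2 (h3 l hl')

theorem exists_perm_lt (s : Finset ℕ) {w : ℕ} (h : s.card ≤ w) :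
    ∃ π : Equiv.Perm ℕ, ∀ x ∈ s, π x < w := by
  induction hn : (s.filter fun x => w ≤ x).card generalizing s with
  | zero =>
    refine ⟨1, fun x hx => ?_⟩
    by_contra hlt
    have := Finset.card_eq_zero.1 hn ▸ Finset.mem_filter.2 ⟨hx, not_lt.1 hlt⟩
    simp at this
  | succ n ih =>
    obtain ⟨x, hx⟩ := Finset.card_pos.1 (by omega : 0 < (s.filter fun x => w ≤ x).card)
    obtain ⟨hxs, hxw⟩ := Finset.mem_filter.1 hx
    -- some number below `w` is free
    obtain ⟨y, hyw, hys⟩ : ∃ y, y < w ∧ y ∉ s := by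
      by_contra hcon
      push Not at hcon
      have hsub : insert x (Finset.range w) ⊆ s := by
        intro y hy
        rcases Finset.mem_insert.1 hy with rfl | hy
        · exact hxs
        · exact hcon y (Finset.mem_range.1 hy)
      have := Finset.card_le_card hsub
      rw [Finset.card_insert_of_notMem (by simpa using hxw), Finset.card_range] at this
      omega
    have hswap : ((s.map (Equiv.swap x y).toEmbedding).filter fun z => w ≤ z) =
        (s.filter fun z => w ≤ z).erase x := by
      ext z
      simp only [Finset.mem_filter, Finset.mem_map_equiv, Equiv.symm_swap, Finset.mem_erase]
      by_cases hzx : z = x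
      · subst hzx; simp [hys]
      · by_cases hzy : z = y
        · subst hzy; simp; omega
        · simp [Equiv.swap_apply_of_ne_of_ne hzx hzy, hzx]
    obtain ⟨π, hπ⟩ := ih (s.map (Equiv.swap x y).toEmbedding) (by simpa using h) (by
      rw [hswap, Finset.card_erase_of_mem hx, hn]; rfl)
    exact ⟨Equiv.trans (Equiv.swap x y) π, fun z hz => hπ _ (Finset.mem_map_of_mem _ hz)⟩

theorem IsVariant.nodup {C D : Clause L} (h : IsVariant C D) (hC : C.Nodup) : D.Nodup := by
  obtain ⟨π, rfl⟩ := h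
  refine hC.map (Function.LeftInverse.injective
    (g := fun l => l.subst fun x => .var (π⁻¹ x)) fun l => ?_)
  dsimp only
  rw [Lit.subst_subst]
  conv_rhs => rw [← Lit.subst_var l]
  simp [Term.subst]

/-- Every loosely guarded clause without repeated literals that is not a tautology has a variant
among the representatives. -/
theorem exists_representative {T : Set (Sym L)} {w : ℕ} {C : Clause L} (hC : IsLG C)
    (hT : Clause.syms C ⊆ T) (hw : Clause.width C ≤ w) (hn : C.Nodup) (ht : ¬ IsTautology C) :
    ∃ D ∈ representatives T w, IsVariant C D := by
  obtain ⟨π, hπ⟩ := exists_perm_lt (Clause.vars C) hw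
  have hv : IsVariant C (Clause.subst C fun x => .var (π x)) := ⟨π, rfl⟩
  refine ⟨_, ⟨hv.nodup hn, fun h => ht (hv.symm.isTautology h), fun l hl => ?_⟩, hv⟩
  refine mem_boundedTerms (Clause.syms_subset_iff.1 (hv.syms_subset hT) l hl) (fun x hx => ?_)
    (depth_expr_le_two (hv.isLG_and_width_le hC).1.1 hl)
  rw [Atom.varFinset_expr] at hx
  obtain ⟨y, hy, hx⟩ := Clause.mem_vars_subst.1 (Clause.mem_vars.2 ⟨l, hl, hx⟩)
  simp only [Term.varFinset, Finset.mem_singleton] at hx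
  exact hx ▸ hπ y hy

/-- The representatives without a variant in `M`. -/
def missing (T : Set (Sym L)) (w : ℕ) (M : Set (Clause L)) : Set (Clause L) :=
  {D ∈ representatives T w | ¬ ∃ C ∈ M, IsVariant C D}

variable [Nonempty L.Constants]

/-- Each step either makes fewer representatives missing, or it keeps their number and makes the
clause set smaller. -/
theorem Step.measure_lt {P : Precedence L} {sel : SelectNC L} {e : Eligibility}
    {N M M' : Set (Clause L)} (h : Step P sel e M M') {T : Set (Sym L)} (hT : T.Finite) {w : ℕ}
    (hNT : ∀ C ∈ N, Clause.syms C ⊆ T) (hNw : ∀ C ∈ N, Clause.width C ≤ w) (hM : BoundedBy N M) :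
    toLex ((missing T w M').ncard, M'.ncard) < toLex ((missing T w M).ncard, M.ncard) := by
  have hfin : ∀ M, (missing T w M).Finite := fun M =>
    (finite_representatives hT w).subset fun _ h => h.1
  have hM' := h.boundedBy hM
  rw [Prod.Lex.toLex_lt_toLex]
  cases h with
  | deduce _ R hR hdel =>
    left
    have hmem : Clause.merge R ∈ insert (Clause.merge R) M := Set.mem_insert _ _
    obtain ⟨C₀, hC₀, hw⟩ := hM'.width _ hmem
    obtain ⟨D, hD, hv⟩ := exists_representative (hM'.isLG _ hmem)
      ((hM'.syms _ hmem).trans (Set.iUnion₂_subset hNT)) (hw.trans (hNw C₀ hC₀))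
      (Clause.nodup_merge R) fun h => hdel (.inl h)
    refine Set.ncard_lt_ncard ⟨fun D' hD' => ⟨hD'.1, fun ⟨C, hC, h⟩ => hD'.2 ⟨C, .inr hC, h⟩⟩,
      fun hsub => ?_⟩ (hfin _)
    have : D ∈ missing T w M := ⟨hD, fun ⟨C, hC, h⟩ => hdel (.inr ⟨C, hC, h.trans hv.symm⟩)⟩
    exact (hsub this).2 ⟨_, hmem, hv⟩
  | delete _ C hC hdel =>
    have hsub : missing T w M' ⊆ missing T w (insert C M') := by
      rintro D ⟨hD, hD'⟩
      refine ⟨hD, ?_⟩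
      rintro ⟨C', rfl | hC', h⟩
      · rcases hdel with ht | ⟨C'', hC'', hv⟩
        · exact hD.2.1 (h.isTautology ht)
        · exact hD' ⟨C'', hC'', hv.trans h⟩
      · exact hD' ⟨C', hC', h⟩
    rcases (Set.ncard_le_ncard hsub (hfin _)).lt_or_eq with hlt | heq
    · exact .inl hlt
    · refine .inr ⟨heq, ?_⟩
      simp only
      rw [Set.ncard_insert_of_notMem hC hM'.finite]
      omega

theorem not_exists_infinite_derivation (P : Precedence L) (sel : SelectNC L) (e : Eligibility)
    {N : Set (Clause L)} (hN : N.Finite) (hLG : ∀ C ∈ N, IsLG C) :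
    ¬ ∃ f : ℕ → Set (Clause L), f 0 = N ∧ ∀ k, Step P sel e (f k) (f (k + 1)) := by
  rintro ⟨f, h0, hf⟩
  have hb : ∀ k, BoundedBy N (f k) := fun k => by
    induction k with
    | zero => rw [h0]; exact .refl hN hLG
    | succ k ih => exact (hf k).boundedBy ih
  have hT : (⋃ C ∈ N, Clause.syms C).Finite := hN.biUnion fun C _ => C.finite_syms
  obtain ⟨w, hw⟩ := (hN.image Clause.width).bddAbove
  obtain ⟨k, hk⟩ := WellFounded.not_rel_apply_succ (r := (· < ·))
    fun k => toLex ((missing (⋃ C ∈ N, Clause.syms C) w (f k)).ncard, (f k).ncard)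
  exact hk ((hf k).measure_lt hT (fun C hC => Set.subset_biUnion_of_mem (u := Clause.syms) hC)
    (fun C hC => hw (Set.mem_image_of_mem _ hC)) (hb k))

end Termination

/-! ### Soundness -/

section Soundness

variable {L : FirstOrder.Language.{u, v}}

/-- The clause is true in the structure `M` under every assignment. -/
def Clause.Valid (M : Type*) [L.Structure M] (C : Clause L) : Prop :=
  ∀ w : ℕ → M, ∃ l ∈ C, Lit.Holds w l

variable {M : Type*} [L.Structure M]

theorem Lit.holds_subst {w : ℕ → M} {l : Lit L} {σ : Sub L} :
    Lit.Holds w (l.subst σ) ↔ Lit.Holds (fun x => (σ x).realize w) l := by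
  cases l <;> simp [Lit.Holds, Lit.subst, Atom.subst]

theorem Clause.Valid.holds_subst {C : Clause L} (h : Clause.Valid M C) (σ : Sub L) (w : ℕ → M) :
    ∃ l ∈ C, Lit.Holds w (l.subst σ) := by
  obtain ⟨l, hl, h⟩ := h fun x => (σ x).realize w
  exact ⟨l, hl, Lit.holds_subst.2 h⟩

theorem Clause.Valid.subst {C : Clause L} (h : Clause.Valid M C) (σ : Sub L) :
    Clause.Valid M (Clause.subst C σ) := fun w => by
  obtain ⟨l, hl, h⟩ := h.holds_subst σ w
  exact ⟨_, Clause.mem_subst.2 ⟨l, hl, rfl⟩, h⟩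

theorem Clause.Valid.variant {C D : Clause L} (h : Clause.Valid M C) (hv : IsVariant C D) :
    Clause.Valid M D := by
  obtain ⟨π, rfl⟩ := hv
  exact h.subst _

theorem Lit.not_holds_neg {w : ℕ → M} {A : Atom L} :
    ¬ Lit.Holds w (.neg A) ↔ Lit.Holds w (.pos A) :=
  not_not

theorem IsTautology.valid {C : Clause L} (h : IsTautology C) : Clause.Valid M C := fun w => by
  obtain ⟨A, h1, h2⟩ := h
  by_cases hA : Lit.Holds w (.pos A)
  · exact ⟨_, h1, hA⟩
  · exact ⟨_, h2, hA⟩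

theorem Clause.valid_merge {C : Clause L} : Clause.Valid M (Clause.merge C) ↔ Clause.Valid M C := by
  simp only [Clause.Valid, Clause.mem_merge]

theorem Factor.valid {P : Precedence L} {sel : SelectNC L} {e : Eligibility} {C R : Clause L}
    (hR : Factor P sel e C R) (hC : Clause.Valid M C) : Clause.Valid M R := by
  obtain ⟨D, A₁, A₂, σ, -, -, hσ⟩ := hR
  intro w
  have hA : A₁.subst σ = A₂.subst σ := hσ.1 () trivial
  obtain ⟨l, hl, h⟩ := hC.holds_subst σ w
  rcases Multiset.mem_cons.1 hl with rfl | hl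
  · exact ⟨_, Clause.mem_subst.2 ⟨_, Multiset.mem_cons_self _ _, rfl⟩, h⟩
  rcases Multiset.mem_cons.1 hl with rfl | hl
  · refine ⟨_, Clause.mem_subst.2 ⟨_, Multiset.mem_cons_self _ _, rfl⟩, ?_⟩
    simpa only [Lit.subst, hA] using h
  · exact ⟨_, Clause.mem_subst.2 ⟨l, Multiset.mem_cons_of_mem hl, rfl⟩, h⟩

theorem TRes.valid {P : Precedence L} {sel : SelectNC L} {e : Eligibility} {n : ℕ}
    {sides : Fin n → Clause L} {S : Finset (Fin n)} {main R : Clause L}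
    (hR : TRes P sel e sides S main R) (hmain : Clause.Valid M main)
    (hsides : ∀ i, Clause.Valid M (sides i)) : Clause.Valid M R := by
  intro w
  cases hR with
  | binary A B E D σ _ hσ _ _ =>
    have hAB : A.subst σ = B.subst σ := hσ.1 () trivial
    simp only [Clause.mem_subst, exists_exists_and_eq_and, Multiset.mem_add]
    obtain ⟨l, hl, h⟩ := hmain.holds_subst σ w
    rcases Multiset.mem_cons.1 hl with rfl | hl
    · obtain ⟨l', hl', h'⟩ := (hsides 0).holds_subst σ w
      rcases Multiset.mem_cons.1 hl' with rfl | hl'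
      · simp only [Lit.subst, hAB] at h h'
        exact absurd h (Lit.not_holds_neg.2 h')
      · exact ⟨l', .inl hl', h'⟩
    · exact ⟨l, .inr hl, h⟩
  | topVariable A B E D σ' σ S _ _ _ _ _ _ _ hσ _ =>
    simp only [Clause.mem_subst, exists_exists_and_eq_and]
    obtain ⟨l, hl, h⟩ := hmain.holds_subst σ w
    rcases Multiset.mem_add.1 hl with hl | hl
    · obtain ⟨i, -, rfl⟩ := Multiset.mem_map.1 hl
      by_cases hi : i ∈ S
      · obtain ⟨l', hl', h'⟩ := (hsides i).holds_subst σ w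
        rcases Multiset.mem_cons.1 hl' with rfl | hl'
        · simp only [Lit.subst, hσ.1 i hi] at h h'
          exact absurd h (Lit.not_holds_neg.2 h')
        · exact ⟨l', Multiset.mem_add.2 (.inl (Multiset.mem_add.2 (.inl
            (Multiset.mem_sum.2 ⟨i, hi, hl'⟩)))), h'⟩
      · exact ⟨_, Multiset.mem_add.2 (.inl (Multiset.mem_add.2 (.inr
          (Multiset.mem_map.2 ⟨i, by simpa using hi, rfl⟩)))), h⟩
    · exact ⟨l, Multiset.mem_add.2 (.inr hl), h⟩

theorem Infers.valid {P : Precedence L} {sel : SelectNC L} {e : Eligibility} {N : Set (Clause L)}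
    {R : Clause L} (hR : Infers P sel e N R) (hN : ∀ C ∈ N, Clause.Valid M C) :
    Clause.Valid M R := by
  cases hR with
  | factor C C' R hC hv hR => exact hR.valid ((hN C hC).variant hv)
  | tres sides S main R hs hm hR =>
    obtain ⟨D, hD, hv⟩ := hm
    refine hR.valid ((hN D hD).variant hv) fun i => ?_
    obtain ⟨C, hC, hv⟩ := hs i
    exact (hN C hC).variant hv

theorem Step.valid_iff {P : Precedence L} {sel : SelectNC L} {e : Eligibility}
    {N N' : Set (Clause L)} (h : Step P sel e N N') :
    (∀ C ∈ N, Clause.Valid M C) ↔ ∀ C ∈ N', Clause.Valid M C := by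
  cases h with
  | deduce N R hR _ =>
    refine ⟨fun h => ?_, fun h C hC => h C (.inr hC)⟩
    rintro C (rfl | hC)
    · exact Clause.valid_merge.2 (hR.valid h)
    · exact h C hC
  | delete N C _ hdel =>
    refine ⟨fun h C hC => h C (.inr hC), fun h => ?_⟩
    rintro D (rfl | hD)
    · rcases hdel with ht | ⟨C, hC, hv⟩
      · exact ht.valid
      · exact (h C hC).variant hv
    · exact h D hD

theorem Derives.satisfiable_iff {P : Precedence L} {sel : SelectNC L} {e : Eligibility}
    {N N' : Set (Clause L)} (h : Derives P sel e N N') : Satisfiable N ↔ Satisfiable N' := by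
  induction h with
  | refl => rfl
  | tail _ h ih =>
    rw [ih]
    exact exists_congr fun M => exists_congr fun _ => exists_congr fun _ => h.valid_iff

theorem not_satisfiable_of_zero_mem {N : Set (Clause L)} (h : (0 : Clause L) ∈ N) :
    ¬ Satisfiable N := by
  rintro ⟨M, ⟨a⟩, _, hM⟩
  obtain ⟨l, hl, -⟩ := hM 0 h fun _ => a
  simp at hl

end Soundness

/-! ### The candidate model -/

section Candidate

variable {L : FirstOrder.Language.{u, v}}

/-- Truth of a ground literal in the Herbrand interpretation given by a set of atoms. -/
def Lit.TrueIn (I : Atom L → Prop) (l : Lit L) : Prop := I l.atom ↔ ¬ l.IsNeg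

theorem Lit.not_trueIn_iff {I : Atom L → Prop} {l : Lit L} :
    ¬ l.TrueIn I ↔ (I l.atom ↔ l.IsNeg) := by
  unfold Lit.TrueIn
  tauto

/-- The candidate model of Bachmair and Ganzinger: an atom is true if it is the strictly maximal
literal of a ground instance of a clause of `N` without selected literals, and the other literals
of this instance, which have smaller atoms, are false. -/
def candidate (P : Precedence L) (sel : SelectNC L) (N : Set (Clause L)) : Atom L → Prop :=
  (InvImage.wf Atom.expr (LPO.wellFounded P.wf)).fix fun A rec =>
    ∃ (B : Atom L) (E : Clause L) (τ : Sub L), Lit.pos B ::ₘ E ∈ N ∧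
      sel.selected (Lit.pos B ::ₘ E) = 0 ∧ IsGroundSub τ ∧ B.subst τ = A ∧
      ∀ l ∈ E, ∃ h : LPO P.gt A.expr (l.subst τ).atom.expr,
        (rec (l.subst τ).atom h ↔ (l.subst τ).IsNeg)

theorem candidate_iff (P : Precedence L) (sel : SelectNC L) (N : Set (Clause L)) (A : Atom L) :
    candidate P sel N A ↔ ∃ (B : Atom L) (E : Clause L) (τ : Sub L), Lit.pos B ::ₘ E ∈ N ∧
      sel.selected (Lit.pos B ::ₘ E) = 0 ∧ IsGroundSub τ ∧ B.subst τ = A ∧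
      ∀ l ∈ E, LPO P.gt A.expr (l.subst τ).atom.expr ∧
        ¬ (l.subst τ).TrueIn (candidate P sel N) := by
  conv_lhs => rw [candidate, WellFounded.fix_eq]
  simp only [Lit.not_trueIn_iff, ← exists_prop (a := LPO _ _ _)]
  rfl

end Candidate

/-! ### Renaming premises apart -/

section Renaming

/-- The permutation that exchanges the numbers below `K` with those from `m` to `m + K - 1`. -/
def blockSwap (K m : ℕ) (h : K ≤ m) : Equiv.Perm ℕ :=
  Function.Involutive.toPerm
    (fun x => if x < K then x + m else if m ≤ x ∧ x < m + K then x - m else x) (fun x => by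
      dsimp only
      split_ifs <;> omega)

theorem blockSwap_of_lt {K m : ℕ} (h : K ≤ m) {x : ℕ} (hx : x < K) :
    blockSwap K m h x = x + m :=
  if_pos hx

variable {L : FirstOrder.Language.{u, v}}

theorem IsVariant.selected_eq_zero {sel : SelectNC L} {C D : Clause L} (h : IsVariant C D)
    (h0 : sel.selected C = 0) : sel.selected D = 0 := by
  obtain ⟨π, rfl⟩ := h
  have hflat : ∀ l : Lit L, (l.subst fun x => .var (π x)).IsFlat ↔ l.IsFlat := by
    intro l
    unfold Lit.IsFlat
    rw [Lit.atom_subst]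
    refine forall_congr' fun i => not_congr ⟨fun h => ?_, fun h => h.subst _⟩
    by_contra hc
    exact not_isCompound_subst hc (fun x _ => not_isCompound_var _) h
  rw [selected_eq_zero_iff] at h0 ⊢
  rcases h0 with h0 | ⟨h1, h2⟩
  · left
    refine Finset.eq_empty_of_forall_notMem fun z hz => ?_
    obtain ⟨x, hx, -⟩ := Clause.mem_vars_subst.1 hz
    rw [h0] at hx
    simp at hx
  · right
    constructor
    · intro l hl hn
      obtain ⟨l, hl, rfl⟩ := Clause.mem_subst.1 hl
      exact (hflat l).2 (h1 l ‹_› (by simpa using hn))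
    · rcases h2 with ⟨l, hl, hn, hf⟩ | h2
      · exact .inl ⟨_, Clause.mem_subst.2 ⟨l, hl, rfl⟩, by simpa using hn, by rwa [hflat]⟩
      · right
        intro l hl
        obtain ⟨l, hl, rfl⟩ := Clause.mem_subst.1 hl
        simpa using h2 l ‹_›

/-- Clauses that produce true instances of the atoms `A i` can be renamed apart from each other and
from the main premise `C`, and the ground substitutions can be glued together. -/
theorem exists_side_premises {P : Precedence L} {sel : SelectNC L} {N : Set (Clause L)}
    (C : Clause L) {τ : Sub L} (hτ : IsGroundSub τ) {n : ℕ} (A : Fin n → Atom L)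
    (hA : ∀ i, candidate P sel N ((A i).subst τ)) :
    ∃ (B : Fin n → Atom L) (E : Fin n → Clause L) (θ : Sub L), IsGroundSub θ ∧
      (∀ x ∈ Clause.vars C, θ x = τ x) ∧
      (∀ i, ∃ D ∈ N, IsVariant D (Lit.pos (B i) ::ₘ E i)) ∧
      (∀ i, sel.selected (Lit.pos (B i) ::ₘ E i) = 0) ∧
      (∀ i j, i ≠ j → Disjoint (Clause.vars (Lit.pos (B i) ::ₘ E i))
        (Clause.vars (Lit.pos (B j) ::ₘ E j))) ∧
      (∀ i, Disjoint (Clause.vars (Lit.pos (B i) ::ₘ E i)) (Clause.vars C)) ∧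
      (∀ i, (B i).subst θ = (A i).subst τ) ∧
      ∀ i, ∀ l ∈ E i, LPO P.gt ((A i).subst τ).expr (l.subst θ).atom.expr ∧
        ¬ (l.subst θ).TrueIn (candidate P sel N) := by
  classical
  choose B E ρ hN hsel hρ hB hE using fun i => (candidate_iff P sel N _).1 (hA i)
  -- all variables of the premises are below `K`
  obtain ⟨K, hKC, hKD⟩ : ∃ K, (∀ x ∈ Clause.vars C, x < K) ∧
      ∀ i, ∀ x ∈ Clause.vars (Lit.pos (B i) ::ₘ E i), x < K := by
    refine ⟨(Clause.vars C ∪ Finset.univ.biUnion fun i =>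
      Clause.vars (Lit.pos (B i) ::ₘ E i)).sup id + 1, fun x hx => ?_, fun i x hx => ?_⟩
    · exact Nat.lt_succ_of_le (Finset.le_sup (f := id) (Finset.mem_union_left _ hx))
    · exact Nat.lt_succ_of_le (Finset.le_sup (f := id) (Finset.mem_union_right _
        (Finset.mem_biUnion.2 ⟨i, Finset.mem_univ i, hx⟩)))
  -- the variables of the side premise with index `i` are moved to block `i + 1` of length `K`
  let π : Fin n → Equiv.Perm ℕ := fun i =>
    blockSwap K ((i + 1) * K) (Nat.le_mul_of_pos_left K (Nat.succ_pos _))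
  have hπ : ∀ i x, x < K → π i x / K = i + 1 ∧ π i x % K = x := by
    intro i x hx
    have : π i x = x + (i + 1) * K := blockSwap_of_lt _ hx
    rw [this, Nat.add_mul_div_right _ _ (by omega), Nat.div_eq_of_lt hx, Nat.add_mul_mod_self_right,
      Nat.mod_eq_of_lt hx]
    omega
  let r : Fin n → Sub L := fun i x => .var (π i x)
  let θ : Sub L := fun x =>
    if h : 0 < x / K ∧ x / K - 1 < n then ρ ⟨x / K - 1, h.2⟩ (x % K) else τ x
  have hθC : ∀ x ∈ Clause.vars C, θ x = τ x := fun x hx =>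
    dif_neg (by rw [Nat.div_eq_of_lt (hKC x hx)]; simp)
  have hθr : ∀ i x, x < K → (r i x).subst θ = ρ i x := by
    intro i x hx
    obtain ⟨h1, h2⟩ := hπ i x hx
    have h3 : 0 < π i x / K ∧ π i x / K - 1 < n := by rw [h1]; omega
    have h4 : (⟨π i x / K - 1, h3.2⟩ : Fin n) = i := Fin.ext (by simp [h1])
    change θ (π i x) = ρ i x
    simp only [θ, dif_pos h3, h4, h2]
  have hvars : ∀ i, ∀ z ∈ Clause.vars (Clause.subst (Lit.pos (B i) ::ₘ E i) (r i)),
      z / K = i + 1 := by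
    intro i z hz
    obtain ⟨x, hx, hz⟩ := Clause.mem_vars_subst.1 hz
    simp only [r, Term.varFinset, Finset.mem_singleton] at hz
    rw [hz, (hπ i x (hKD i x hx)).1]
  have hcons : ∀ i, Clause.subst (Lit.pos (B i) ::ₘ E i) (r i) =
      Lit.pos ((B i).subst (r i)) ::ₘ Clause.subst (E i) (r i) := fun i => Clause.subst_cons _ _ _
  have hvariant : ∀ i, IsVariant (Lit.pos (B i) ::ₘ E i)
      (Lit.pos ((B i).subst (r i)) ::ₘ Clause.subst (E i) (r i)) := fun i => ⟨π i, (hcons i).symm⟩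
  have hlit : ∀ i, ∀ l ∈ Lit.pos (B i) ::ₘ E i, (l.subst (r i)).subst θ = l.subst (ρ i) := by
    intro i l hl
    rw [Lit.subst_subst]
    exact Lit.subst_congr fun x hx => hθr i x (hKD i x (Clause.mem_vars.2 ⟨l, hl, hx⟩))
  refine ⟨fun i => (B i).subst (r i), fun i => Clause.subst (E i) (r i), θ, fun x => ?_, hθC,
    fun i => ⟨_, hN i, hvariant i⟩, fun i => (hvariant i).selected_eq_zero (hsel i), ?_, ?_, ?_, ?_⟩
  · simp only [θ]
    split_ifs
    · exact hρ _ _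
    · exact hτ x
  · intro i j hij
    simp only [← hcons]
    refine Finset.disjoint_left.2 fun z hz hz' => hij (Fin.ext ?_)
    have := (hvars i z hz).symm.trans (hvars j z hz')
    omega
  · intro i
    simp only [← hcons]
    refine Finset.disjoint_left.2 fun z hz hz' => ?_
    have := (hvars i z hz).symm.trans (Nat.div_eq_of_lt (hKC z hz'))
    omega
  · intro i
    have := congrArg Lit.atom (hlit i _ (Multiset.mem_cons_self _ _))
    exact this.trans (hB i)
  · intro i l hl
    obtain ⟨l, hl, rfl⟩ := Clause.mem_subst.1 hl
    rw [hlit i l (Multiset.mem_cons_of_mem ‹_›)]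
    exact hE i l ‹_›

end Renaming

/-! ### Refutational completeness -/

section Completeness

variable {L : FirstOrder.Language.{u, v}}

/-- The ranks of the literals of a ground clause. Ground clauses are compared by the multiset
extension of the literal ordering. -/
def Precedence.ranks (P : Precedence L) (C : Clause L) : Multiset Ordinal.{max u v} := C.map P.rank

@[simp]
theorem Precedence.ranks_add (P : Precedence L) (C D : Clause L) :
    P.ranks (C + D) = P.ranks C + P.ranks D := Multiset.map_add _ _ _

theorem isDershowitzMannaLT_of_le {α : Type*} [Preorder α] {s t r : Multiset α} (h : s ≤ t)
    (h' : t.IsDershowitzMannaLT r) : s.IsDershowitzMannaLT r := by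
  obtain ⟨d, rfl⟩ := Multiset.le_iff_exists_add.1 h
  by_cases hd : d = 0
  · simpa [hd] using h'
  · exact Multiset.IsDershowitzMannaLT.trans ⟨s, 0, d, hd, by simp, rfl, by simp⟩ h'

/-- All ground instances below `μ` of the clauses of `N` are true in the candidate model. -/
def TrueBelow (P : Precedence L) (sel : SelectNC L) (N : Set (Clause L))
    (μ : Multiset Ordinal.{max u v}) : Prop :=
  ∀ C ∈ N, ∀ τ : Sub L, IsGroundSub τ → (P.ranks (Clause.subst C τ)).IsDershowitzMannaLT μ →
    ∃ l ∈ C, (l.subst τ).TrueIn (candidate P sel N)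

/-- In a saturated set, conclusions of inferences have no false instances below a minimal false
instance of a clause. -/
theorem TrueBelow.false_of_infers {P : Precedence L} {sel : SelectNC L} {e : Eligibility}
    {N : Set (Clause L)} {μ : Multiset Ordinal.{max u v}} (hμ : TrueBelow P sel N μ)
    (hsat : Saturated P sel e N) {K : Clause L} {σ η θ : Sub L}
    (hR : Infers P sel e N (Clause.subst K σ)) (hη : IsGroundSub η)
    (hση : ∀ x, θ x = (σ x).subst η)
    (hK : ∀ l ∈ K, ¬ (l.subst θ).TrueIn (candidate P sel N))
    (hlt : (P.ranks (Clause.subst K θ)).IsDershowitzMannaLT μ) : False := by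
  have hKθ : Clause.subst (Clause.subst K σ) η = Clause.subst K θ := by
    rw [Clause.subst_subst, ← funext hση]
  have hfalse : ∀ l ∈ Clause.merge (Clause.subst K σ),
      ¬ (l.subst η).TrueIn (candidate P sel N) := by
    intro l hl
    have : l.subst η ∈ Clause.subst (Clause.subst K σ) η :=
      Clause.mem_subst.2 ⟨l, Clause.mem_merge.1 hl, rfl⟩
    rw [hKθ] at this
    obtain ⟨l', hl', h⟩ := Clause.mem_subst.1 this
    exact h ▸ hK l' hl'
  rcases hsat _ hR with ⟨A, h1, h2⟩ | ⟨C, hC, π, hπ⟩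
  · have h1 := Lit.not_trueIn_iff.1 (hfalse _ h1)
    have h2 := Lit.not_trueIn_iff.1 (hfalse _ h2)
    exact h1.1 (h2.2 trivial)
  · have hCη : Clause.subst C (fun x => η (π x)) =
        Clause.subst (Clause.merge (Clause.subst K σ)) η := by
      rw [hπ, Clause.subst_subst]; rfl
    obtain ⟨l, hl, h⟩ := hμ C hC (fun x => η (π x)) (fun x => hη _) (by
      rw [hCη]
      refine isDershowitzMannaLT_of_le (Multiset.map_le_map ?_) (hKθ ▸ hlt)
      exact Multiset.map_le_map (Clause.merge_le _))
    have : l.subst (fun x => η (π x)) ∈ Clause.subst C fun x => η (π x) :=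
      Clause.mem_subst.2 ⟨l, hl, rfl⟩
    rw [hCη] at this
    obtain ⟨l', hl', h'⟩ := Clause.mem_subst.1 this
    exact hfalse l' hl' (h' ▸ h)

theorem exists_max_literal (P : Precedence L) {C : Clause L} (hC : C ≠ 0) {τ : Sub L}
    (hτ : IsGroundSub τ) : ∃ l₀ ∈ C, ∀ l ∈ C, l₀.subst τ = l.subst τ ∨
      P.LitGT (l₀.subst τ) (l.subst τ) := by
  obtain ⟨a, ha⟩ := Multiset.exists_mem_of_ne_zero hC
  obtain ⟨l₀, hl₀, hmax⟩ := Set.exists_max_image {l | l ∈ C} (fun l => P.rank (l.subst τ))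
    (Multiset.finite_toSet C) ⟨a, ha⟩
  have hg : ∀ l : Lit L, (l.subst τ).vars = ∅ := fun l =>
    Finset.eq_empty_of_forall_notMem fun z hz => by
      obtain ⟨y, -, hy⟩ := Lit.mem_vars_subst.1 hz
      rw [hτ y] at hy
      simp at hy
  refine ⟨l₀, hl₀, fun l hl => ?_⟩
  rcases P.litGT_total (hg l₀) (hg l) with h | h | h
  · exact .inl h
  · exact .inr h
  · exact absurd (P.rank_lt h) (hmax l hl).not_gt

/-- The Herbrand universe. -/
abbrev GroundTerm (L : FirstOrder.Language.{u, v}) : Type max u v :=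
  ULift.{max u v} {t : L.Term ℕ // t.varFinset = ∅}

/-- The Herbrand structure in which exactly the atoms in `I` are true. -/
@[reducible]
def herbrand (I : Atom L → Prop) : L.Structure (GroundTerm L) where
  funMap f ts := ⟨.func f fun i => (ts i).down.1, by
    refine Finset.eq_empty_of_forall_notMem fun x hx => ?_
    simp only [Term.varFinset, Finset.mem_biUnion] at hx
    obtain ⟨i, -, hx⟩ := hx
    rw [(ts i).down.2] at hx
    simp at hx⟩
  RelMap p ts := I ⟨_, p, fun i => (ts i).down.1⟩

theorem herbrand_realize (I : Atom L → Prop) (w : ℕ → GroundTerm L) (t : L.Term ℕ) :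
    letI := herbrand I
    (t.realize w).down.1 = t.subst fun x => (w x).down.1 := by
  let := herbrand I
  induction t with
  | var x => rfl
  | func f ts ih =>
    simp only [Term.subst, ← ih]
    rfl

theorem herbrand_holds (I : Atom L → Prop) (w : ℕ → GroundTerm L) (l : Lit L) :
    letI := herbrand I
    Lit.Holds w l ↔ (l.subst fun x => (w x).down.1).TrueIn I := by
  let := herbrand I
  have hA : ∀ A : Atom L, FirstOrder.Language.Structure.RelMap A.rel
      (fun i => (A.args i).realize w) ↔ I (A.subst fun x => (w x).down.1) := by
    intro A
    simp only [Atom.subst, ← herbrand_realize I]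
    rfl
  cases l <;> simp [Lit.Holds, Lit.TrueIn, Lit.IsNeg, hA, Lit.subst, Lit.atom]

variable [Nonempty L.Constants]

theorem IsMGU.exists_under {ι : Type*} {A B : ι → Atom L} {S : Set ι} {σ θ : Sub L}
    (hσ : IsMGU A B S σ) (hθ : IsUnifier A B S θ) (hg : IsGroundSub θ) (e : Eligibility) :
    ∃ η : Sub L, IsGroundSub η ∧ θ = fun x => (e.under σ x).subst η := by
  cases e with
  | aPriori => exact ⟨θ, hg, rfl⟩
  | aPosteriori =>
    obtain ⟨η, h1, h2⟩ := hσ.exists_ground hθ hg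
    exact ⟨η, h1, funext h2⟩

theorem IsMGU.isSide {ι : Type*} {A B : ι → Atom L} {S : Set ι} {σ θ : Sub L}
    (hσ : IsMGU A B S σ) (hθ : IsUnifier A B S θ) (hg : IsGroundSub θ) (e : Eligibility)
    {P : Precedence L} {sel : SelectNC L} {B' : Atom L} {E : Clause L}
    (hsel : sel.selected (Lit.pos B' ::ₘ E) = 0)
    (hE : ∀ l ∈ E, LPO P.gt (B'.subst θ).expr (l.subst θ).atom.expr) :
    IsSide P sel (e.under σ) B' E := by
  obtain ⟨η, hη, rfl⟩ := hσ.exists_under hθ hg e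
  refine ⟨hsel, η, hη, fun l hl => ?_⟩
  obtain ⟨l, hl, rfl⟩ := Clause.mem_subst.1 hl
  rw [Lit.subst_subst]
  change P.LitGT (Lit.pos ((B'.subst _).subst η)) _
  rw [Atom.subst_subst]
  exact .inl (hE l ‹_›)

theorem IsMGU.isMax {ι : Type*} {A B : ι → Atom L} {S : Set ι} {σ θ : Sub L}
    (hσ : IsMGU A B S σ) (hθ : IsUnifier A B S θ) (hg : IsGroundSub θ) (e : Eligibility)
    {P : Precedence L} {l₀ : Lit L} {D : Clause L}
    (hD : ∀ l ∈ D, l₀.subst θ = l.subst θ ∨ P.LitGT (l₀.subst θ) (l.subst θ)) :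
    P.IsMax (l₀.subst (e.under σ)) (Clause.subst D (e.under σ)) := by
  obtain ⟨η, hη, rfl⟩ := hσ.exists_under hθ hg e
  refine ⟨η, hη, fun l hl => ?_⟩
  obtain ⟨l, hl, rfl⟩ := Clause.mem_subst.1 hl
  rw [Lit.subst_subst, Lit.subst_subst]
  exact hD l ‹_›

/-- A minimal false instance cannot be resolved upon a single literal. -/
theorem TrueBelow.false_of_binary {P : Precedence L} {sel : SelectNC L} {e : Eligibility}
    {N : Set (Clause L)} (hsat : Saturated P sel e N) {A : Atom L} {D : Clause L} {τ : Sub L}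
    (hτ : IsGroundSub τ) (hN : Lit.neg A ::ₘ D ∈ N)
    (hμ : TrueBelow P sel N (P.ranks (Clause.subst (Lit.neg A ::ₘ D) τ)))
    (hfalse : ∀ l ∈ Lit.neg A ::ₘ D, ¬ (l.subst τ).TrueIn (candidate P sel N))
    (hsel : sel.selected (Lit.neg A ::ₘ D) = {Lit.neg A} ∨
      (sel.selected (Lit.neg A ::ₘ D) = 0 ∧ ∀ l ∈ D, (Lit.neg A).subst τ = l.subst τ ∨
        P.LitGT ((Lit.neg A).subst τ) (l.subst τ))) : False := by
  have hA : candidate P sel N (A.subst τ) :=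
    (Lit.not_trueIn_iff.1 (hfalse _ (Multiset.mem_cons_self _ _))).2 trivial
  obtain ⟨B, E, θ, hθ, hθC, hvar, hsel', -, hdisj, hB, hE⟩ :=
    exists_side_premises (Lit.neg A ::ₘ D) hτ (fun _ : Fin 1 => A) fun _ => hA
  have hAθ : A.subst θ = A.subst τ := Atom.subst_congr fun x hx =>
    hθC x (Clause.mem_vars.2 ⟨_, Multiset.mem_cons_self _ _, hx⟩)
  have hDθ : ∀ l ∈ D, l.subst θ = l.subst τ := fun l hl => Lit.subst_congr fun x hx =>
    hθC x (Clause.mem_vars.2 ⟨l, Multiset.mem_cons_of_mem hl, hx⟩)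
  have hu : IsUnifier (fun _ : Unit => A) (fun _ => B 0) Set.univ θ := fun _ _ => by
    rw [hAθ, hB 0]
  obtain ⟨σ, hσ⟩ := exists_mgu (fun _ : Unit => A) (fun _ => B 0) Finset.univ
    (by rwa [Finset.coe_univ])
  rw [Finset.coe_univ] at hσ
  obtain ⟨η, hη, hση⟩ := hσ.exists_ground hu hθ
  have hR : Infers P sel e N (Clause.subst (E 0 + D) σ) := by
    refine .tres (fun _ : Fin 1 => Lit.pos (B 0) ::ₘ E 0) Finset.univ (Lit.neg A ::ₘ D) _
      (fun _ => hvar 0) ⟨_, hN, .refl _⟩ (.binary A (B 0) (E 0) D σ (hdisj 0) hσ ?_ ?_)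
    · exact hσ.isSide hu hθ e (hsel' 0) fun l hl => by rw [hB 0]; exact (hE 0 l hl).1
    · refine hsel.imp_right fun ⟨h0, hmax⟩ => ⟨h0, ?_⟩
      refine hσ.isMax hu hθ e (l₀ := Lit.neg A) fun l hl => ?_
      rw [hDθ l hl]
      simp only [Lit.subst, hAθ] at hmax ⊢
      exact hmax l hl
  refine hμ.false_of_infers hsat hR hη hση (fun l hl => ?_) ?_
  · rcases Multiset.mem_add.1 hl with h | h
    · exact (hE 0 l h).2
    · rw [hDθ l h]; exact hfalse l (Multiset.mem_cons_of_mem h)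
  · refine ⟨P.ranks (Clause.subst D τ), P.ranks (Clause.subst (E 0) θ),
      {P.rank (.neg (A.subst τ))}, by simp, ?_, ?_, ?_⟩
    · have : Clause.subst D θ = Clause.subst D τ := Multiset.map_congr rfl hDθ
      rw [Clause.subst_add, P.ranks_add, this, add_comm]
    · rw [add_comm, Multiset.singleton_add]
      simp [Precedence.ranks, Lit.subst]
    · intro r hr
      obtain ⟨l, hl, rfl⟩ := Multiset.mem_map.1 hr
      obtain ⟨l, hl, rfl⟩ := Clause.mem_subst.1 hl
      exact ⟨_, Multiset.mem_singleton_self _, P.rank_lt (.inl (hE 0 l ‹_›).1)⟩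

/-- A minimal false instance of a non-ground flat clause cannot be resolved upon the literals that
contain top variables. Resolving some of the selected literals makes the instance smaller just as
resolving all of them does. -/
theorem TrueBelow.false_of_topVariable {P : Precedence L} {sel : SelectNC L} {e : Eligibility}
    {N : Set (Clause L)} (hsat : Saturated P sel e N) {n : ℕ} {A : Fin n → Atom L} {D : Clause L}
    {τ : Sub L} (hτ : IsGroundSub τ) (hN : Finset.univ.val.map (fun i => Lit.neg (A i)) + D ∈ N)
    (hμ : TrueBelow P sel N
      (P.ranks (Clause.subst (Finset.univ.val.map (fun i => Lit.neg (A i)) + D) τ)))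
    (hfalse : ∀ l ∈ Finset.univ.val.map (fun i => Lit.neg (A i)) + D,
      ¬ (l.subst τ).TrueIn (candidate P sel N))
    (hsel : sel.selected (Finset.univ.val.map (fun i => Lit.neg (A i)) + D) =
      Finset.univ.val.map (fun i => Lit.neg (A i)))
    (hne : ∃ i, (A i).vars.Nonempty) : False := by
  classical
  set C := Finset.univ.val.map (fun i => Lit.neg (A i)) + D with hC
  have hAC : ∀ i, Lit.neg (A i) ∈ C := fun i =>
    Multiset.mem_add.2 (.inl (Multiset.mem_map.2 ⟨i, Finset.mem_univ_val i, rfl⟩))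
  have hA : ∀ i, candidate P sel N ((A i).subst τ) := fun i =>
    (Lit.not_trueIn_iff.1 (hfalse _ (hAC i))).2 trivial
  obtain ⟨B, E, θ, hθ, hθC, hvar, hsel', hdisj', hdisj, hB, hE⟩ :=
    exists_side_premises C hτ A hA
  have hCθ : ∀ l ∈ C, l.subst θ = l.subst τ := fun l hl => Lit.subst_congr fun x hx =>
    hθC x (Clause.mem_vars.2 ⟨l, hl, hx⟩)
  have hAθ : ∀ i, (A i).subst θ = (A i).subst τ := fun i => congrArg Lit.atom (hCθ _ (hAC i))
  have hu : ∀ S, IsUnifier A B S θ := fun S i _ => by rw [hAθ, hB i]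
  obtain ⟨σ', hσ'⟩ := exists_mgu A B Finset.univ (hu _)
  rw [Finset.coe_univ] at hσ'
  let S : Finset (Fin n) := Finset.univ.filter fun i => ∃ x ∈ (A i).vars, IsTopVariable A σ' x
  have hS : ∀ i, i ∈ S ↔ ∃ x ∈ (A i).vars, IsTopVariable A σ' x := fun i => by simp [S]
  have hSne : S.Nonempty := by
    obtain ⟨i, x, hx⟩ := hne
    obtain ⟨y, hy, hmax⟩ := Finset.exists_max_image (Finset.univ.biUnion fun i => (A i).vars)
      (fun x => depth (σ' x)) ⟨x, Finset.mem_biUnion.2 ⟨i, Finset.mem_univ i, hx⟩⟩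
    obtain ⟨j, -, hj⟩ := Finset.mem_biUnion.1 hy
    exact ⟨j, (hS j).2 ⟨y, hj, ⟨j, hj⟩, fun k z hz =>
      hmax z (Finset.mem_biUnion.2 ⟨k, Finset.mem_univ k, hz⟩)⟩⟩
  obtain ⟨σ, hσ⟩ := exists_mgu A B S (hu _)
  obtain ⟨η, hη, hση⟩ := hσ.exists_ground (hu _) hθ
  have hside : ∀ i, ∀ l ∈ E i, LPO P.gt ((B i).subst θ).expr (l.subst θ).atom.expr :=
    fun i l hl => by rw [hB i]; exact (hE i l hl).1
  have hR : Infers P sel e N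
      (Clause.subst ((∑ i ∈ S, E i) + (Sᶜ).val.map (fun i => Lit.neg (A i)) + D) σ) := by
    refine .tres _ S C _ hvar ⟨_, hN, .refl _⟩ (.topVariable A B E D σ' σ S hdisj' hdisj hsel hσ'
      (fun i => hσ'.isSide (hu _) hθ e (hsel' i) (hside i)) hS hSne ?_
      (fun i => hσ.isSide (hu _) hθ e (hsel' i) (hside i)))
    convert hσ
  have hcompl : ∀ l ∈ Sᶜ.val.map (fun i => Lit.neg (A i)), l ∈ C := by
    intro l hl
    obtain ⟨i, -, rfl⟩ := Multiset.mem_map.1 hl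
    exact hAC i
  refine hμ.false_of_infers hsat hR hη hση (fun l hl => ?_) ?_
  · rcases Multiset.mem_add.1 hl with h | h
    · rcases Multiset.mem_add.1 h with h | h
      · obtain ⟨i, -, h⟩ := Multiset.mem_sum.1 h
        exact (hE i l h).2
      · rw [hCθ l (hcompl l h)]; exact hfalse l (hcompl l h)
    · rw [hCθ l (Multiset.mem_add.2 (.inr h))]
      exact hfalse l (Multiset.mem_add.2 (.inr h))
  · have hsplit : Finset.univ.val.map (fun i => Lit.neg (A i)) =
        S.val.map (fun i => Lit.neg (A i)) + Sᶜ.val.map (fun i => Lit.neg (A i)) := by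
      rw [← Multiset.map_add, ← Finset.disjUnion_val S Sᶜ disjoint_compl_right,
        Finset.disjUnion_eq_union, Finset.union_compl]
    refine ⟨P.ranks (Clause.subst (Sᶜ.val.map (fun i => Lit.neg (A i)) + D) τ),
      P.ranks (Clause.subst (∑ i ∈ S, E i) θ),
      P.ranks (Clause.subst (S.val.map fun i => Lit.neg (A i)) τ), ?_, ?_, ?_, ?_⟩
    · obtain ⟨i, hi⟩ := hSne
      simp only [Precedence.ranks, Clause.subst, ne_eq, Multiset.empty_eq_zero,
        Multiset.map_eq_zero, Finset.val_eq_zero]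
      exact Finset.ne_empty_of_mem hi
    · have : Clause.subst (Sᶜ.val.map (fun i => Lit.neg (A i)) + D) θ =
          Clause.subst (Sᶜ.val.map (fun i => Lit.neg (A i)) + D) τ :=
        Multiset.map_congr rfl fun l hl => hCθ l (by
          rcases Multiset.mem_add.1 hl with h | h
          · exact hcompl l h
          · exact Multiset.mem_add.2 (.inr h))
      rw [add_assoc, Clause.subst_add, P.ranks_add, this, add_comm]
    · rw [hC, hsplit, add_assoc, Clause.subst_add, P.ranks_add, add_comm]
    · intro r hr
      obtain ⟨l, hl, rfl⟩ := Multiset.mem_map.1 hr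
      obtain ⟨l, hl', rfl⟩ := Clause.mem_subst.1 hl
      obtain ⟨i, hi, hl'⟩ := Multiset.mem_sum.1 hl'
      refine ⟨P.rank (.neg ((A i).subst τ)), ?_, P.rank_lt (.inl (hE i l hl').1)⟩
      exact Multiset.mem_map_of_mem _ (Clause.mem_subst.2
        ⟨_, Multiset.mem_map.2 ⟨i, hi, rfl⟩, rfl⟩)

/-- A minimal false instance cannot be factored. -/
theorem TrueBelow.false_of_factor {P : Precedence L} {sel : SelectNC L} {e : Eligibility}
    {N : Set (Clause L)} (hsat : Saturated P sel e N) {A A' : Atom L} {D : Clause L} {τ : Sub L}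
    (hτ : IsGroundSub τ) (hN : Lit.pos A ::ₘ Lit.pos A' ::ₘ D ∈ N)
    (hμ : TrueBelow P sel N (P.ranks (Clause.subst (Lit.pos A ::ₘ Lit.pos A' ::ₘ D) τ)))
    (hfalse : ∀ l ∈ Lit.pos A ::ₘ Lit.pos A' ::ₘ D, ¬ (l.subst τ).TrueIn (candidate P sel N))
    (hsel : sel.selected (Lit.pos A ::ₘ Lit.pos A' ::ₘ D) = 0) (hA : A.subst τ = A'.subst τ)
    (hmax : ∀ l ∈ D, (Lit.pos A).subst τ = l.subst τ ∨
      P.LitGT ((Lit.pos A).subst τ) (l.subst τ)) : False := by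
  have hu : IsUnifier (fun _ : Unit => A) (fun _ => A') Set.univ τ := fun _ _ => hA
  obtain ⟨σ, hσ⟩ := exists_mgu (fun _ : Unit => A) (fun _ => A') Finset.univ
    (by rwa [Finset.coe_univ])
  rw [Finset.coe_univ] at hσ
  obtain ⟨η, hη, hση⟩ := hσ.exists_ground hu hτ
  have hR : Infers P sel e N (Clause.subst (Lit.pos A ::ₘ D) σ) :=
    .factor _ _ _ hN (.refl _) (.intro D A A' σ hsel (hσ.isMax hu hτ e hmax) hσ)
  refine hμ.false_of_infers hsat hR hη hση (fun l hl => hfalse l ?_) ?_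
  · simp only [Multiset.mem_cons] at hl ⊢
    tauto
  · refine ⟨P.ranks (Clause.subst (Lit.pos A ::ₘ D) τ), 0, {P.rank (.pos (A'.subst τ))}, by simp,
      by simp, ?_, by simp⟩
    simp only [Precedence.ranks, Clause.subst_cons, Multiset.map_cons, Lit.subst, Multiset.cons_add]
    congr 1
    rw [add_comm, Multiset.singleton_add]

/-- The candidate model of a saturated set of loosely guarded clauses without the empty clause
satisfies all ground instances of the set. -/
theorem candidate_satisfies {P : Precedence L} {sel : SelectNC L} {e : Eligibility}
    {N : Set (Clause L)} (hLG : ∀ C ∈ N, IsLG C) (hsat : Saturated P sel e N)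
    (h0 : (0 : Clause L) ∉ N) {C : Clause L} (hC : C ∈ N) {τ : Sub L} (hτ : IsGroundSub τ) :
    ∃ l ∈ C, (l.subst τ).TrueIn (candidate P sel N) := by
  classical
  have hwf := Multiset.wellFounded_isDershowitzMannaLT (α := Ordinal.{max u v})
  induction hm : P.ranks (Clause.subst C τ) using hwf.induction generalizing C τ with
  | _ μ ih =>
  subst hm
  have hμ : TrueBelow P sel N (P.ranks (Clause.subst C τ)) :=
    fun C' hC' τ' hτ' h => ih _ h hC' hτ' rfl
  clear ih
  by_contra hcon
  push Not at hcon
  by_cases hsel : sel.selected C = 0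
  · obtain ⟨l₀, hl₀, hmax⟩ := exists_max_literal P (fun h => h0 (h ▸ hC)) hτ
    obtain ⟨D, rfl⟩ := Multiset.exists_cons_of_mem hl₀
    rcases l₀ with A | A
    · by_cases hstrict : ∀ l ∈ D, LPO P.gt (A.subst τ).expr (l.subst τ).atom.expr
      · refine hcon _ (Multiset.mem_cons_self _ _) ?_
        simp only [Lit.TrueIn, Lit.subst, Lit.atom, Lit.IsNeg, not_false_eq_true, iff_true]
        exact (candidate_iff P sel N _).2 ⟨A, D, τ, hC, hsel, hτ, rfl, fun l hl =>
          ⟨hstrict l hl, hcon l (Multiset.mem_cons_of_mem hl)⟩⟩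
      · push Not at hstrict
        obtain ⟨l, hl, hnot⟩ := hstrict
        obtain ⟨D, rfl⟩ := Multiset.exists_cons_of_mem hl
        rcases hmax l (Multiset.mem_cons_of_mem hl) with h | h | h
        · rcases l with A' | A'
          · refine hμ.false_of_factor hsat hτ hC hcon hsel (Lit.pos.inj h) fun l hl => ?_
            exact hmax l (Multiset.mem_cons_of_mem (Multiset.mem_cons_of_mem hl))
          · cases h
        · exact hnot h
        · exact h.2.1
    · exact hμ.false_of_binary hsat hτ hC hcon (.inr ⟨hsel, fun l hl =>
        hmax l (Multiset.mem_cons_of_mem hl)⟩)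
  · obtain ⟨hg, ⟨l, hl, hs, hn, -⟩ | ⟨-, hs⟩⟩ := selected_of_ne_zero hsel
    · obtain ⟨D, rfl⟩ := Multiset.exists_cons_of_mem hl
      rcases l with A | A
      · exact hn
      · exact hμ.false_of_binary hsat hτ hC hcon (.inl hs)
    · -- the negative literals of a flat clause are enumerated
      obtain ⟨ls, hls⟩ := Quot.exists_rep (C.filter fun l => l.IsNeg)
      replace hls : (ls : Multiset (Lit L)) = C.filter fun l => l.IsNeg := hls
      have hneg : ∀ l ∈ ls, l.IsNeg := fun l hl =>
        (Multiset.mem_filter.1 (hls ▸ Multiset.mem_coe.2 hl)).2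
      let A : Fin ls.length → Atom L := fun i => (ls.get i).atom
      have hA : Finset.univ.val.map (fun i => Lit.neg (A i)) = C.filter fun l => l.IsNeg := by
        rw [← hls, Fin.univ_val_map]
        congr 1
        conv_rhs => rw [← List.ofFn_get ls]
        congr 1
        funext i
        exact (Lit.eq_neg (hneg _ (List.get_mem ls i))).symm
      have hCA : C =
          Finset.univ.val.map (fun i => Lit.neg (A i)) + C.filter fun l => ¬ l.IsNeg := by
        rw [hA, Multiset.filter_add_not]
      have hex : ∃ i, (A i).vars.Nonempty := by
        obtain ⟨x, hx⟩ := Finset.nonempty_iff_ne_empty.2 hg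
        obtain ⟨l, hl, hn, -, hxl, -⟩ := ((hLG C hC).2.2.2.resolve_left hg) x hx x hx
        have : l ∈ Finset.univ.val.map (fun i => Lit.neg (A i)) := by
          rw [hA]; exact Multiset.mem_filter.2 ⟨hl, hn⟩
        obtain ⟨i, -, rfl⟩ := Multiset.mem_map.1 this
        exact ⟨i, x, hxl⟩
      rw [← hA] at hs
      rw [hCA] at hC hμ hcon hs
      exact TrueBelow.false_of_topVariable hsat hτ hC hμ hcon hs hex

theorem satisfiable_of_saturated {P : Precedence L} {sel : SelectNC L} {e : Eligibility}
    {N : Set (Clause L)} (hLG : ∀ C ∈ N, IsLG C) (hsat : Saturated P sel e N)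
    (h0 : (0 : Clause L) ∉ N) : Satisfiable N := by
  obtain ⟨c⟩ := ‹Nonempty L.Constants›
  refine ⟨GroundTerm L, ⟨⟨.func c Fin.elim0, by simp⟩⟩, herbrand (candidate P sel N),
    fun C hC w => ?_⟩
  obtain ⟨l, hl, h⟩ := candidate_satisfies hLG hsat h0 hC
    (τ := fun x => (w x).down.1) fun x => (w x).down.2
  exact ⟨l, hl, (herbrand_holds _ w l).2 h⟩

theorem not_satisfiable_iff_of_saturated {P : Precedence L} {sel : SelectNC L} {e : Eligibility}
    {N : Set (Clause L)} (hLG : ∀ C ∈ N, IsLG C) (hsat : Saturated P sel e N) :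
    ¬ Satisfiable N ↔ (0 : Clause L) ∈ N :=
  ⟨fun h => by_contra fun h0 => h (satisfiable_of_saturated hLG hsat h0),
    not_satisfiable_of_zero_mem⟩

end Completeness

end TopVar

end

theorem theorem5 {L : FirstOrder.Language.{u, v}} [Nonempty L.Constants]
    (P : Precedence L) (sel : SelectNC L) (e : Eligibility) :
    -- factors of LG clauses are LG clauses, simple, and no wider than the premise
    (∀ C R : Clause L, IsLG C → Factor P sel e C R →
      IsLG R ∧ IsSimple R ∧ Clause.width R ≤ Clause.width C) ∧
    -- resolvents of LG clauses are LG clauses, simple, and no wider than one of the premises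
    (∀ (n : ℕ) (sides : Fin n → Clause L) (S : Finset (Fin n)) (main R : Clause L),
      (∀ i, IsLG (sides i)) → IsLG main → TRes P sel e sides S main R →
      IsLG R ∧ IsSimple R ∧
        (Clause.width R ≤ Clause.width main ∨
          ∃ i ∈ S, Clause.width R ≤ Clause.width (sides i))) ∧
    -- refutational completeness (and soundness) for saturated sets of LG clauses
    (∀ N : Set (Clause L), (∀ C ∈ N, IsLG C) → Saturated P sel e N →
      (¬ Satisfiable N ↔ (0 : Clause L) ∈ N)) ∧
    -- the system is a decision procedure for finite sets of LG clauses
    (∀ N : Set (Clause L), N.Finite → (∀ C ∈ N, IsLG C) →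
      -- there is no infinite derivation
      (¬ ∃ f : ℕ → Set (Clause L), f 0 = N ∧ ∀ k, Step P sel e (f k) (f (k + 1))) ∧
      -- all derived clauses are LG clauses over the given symbols and of bounded width
      (∀ M, Derives P sel e N M → M.Finite ∧ ∀ C ∈ M, IsLG C ∧
        Clause.syms C ⊆ (⋃ C' ∈ N, Clause.syms C') ∧
        ∃ C' ∈ N, Clause.width C ≤ Clause.width C') ∧
      -- a derivation that cannot be continued ends in a saturated set with the right answer
      (∀ M, Derives P sel e N M → (∀ M', ¬ Step P sel e M M') →
        Saturated P sel e M ∧ ((0 : Clause L) ∈ M ↔ ¬ Satisfiable N))) := by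
  refine ⟨fun C R hC hR => ?_, fun n sides S main R hsides hmain hR => ?_,
    fun N hLG hsat => not_satisfiable_iff_of_saturated hLG hsat, fun N hN hLG =>
      ⟨not_exists_infinite_derivation P sel e hN hLG, fun M hM => ?_, fun M hM hfinal => ?_⟩⟩
  · have h := isLG_factor hC hR
    exact ⟨h.1, h.1.1, h.2⟩
  · have h := isLG_tres hsides hmain hR
    exact ⟨h.1, h.1.1, .inr h.2⟩
  · have h := hM.boundedBy (.refl hN hLG)
    exact ⟨h.finite, fun C hC => ⟨h.isLG C hC, h.syms C hC, h.width C hC⟩⟩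
  · have hsat : Saturated P sel e M := fun R hR =>
      by_contra fun h => hfinal _ (Step.deduce M R hR h)
    refine ⟨hsat, ?_⟩
    rw [hM.satisfiable_iff]
    exact (not_satisfiable_iff_of_saturated (hM.boundedBy (.refl hN hLG)).isLG hsat).symm
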